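/- **Setting.** Let $P$ workers have data distributions $D_1,\dots,D_P$ with finite supports, let $\ell(x,z)$ be a loss on $\mathbb R^d$, $f_p(x)=\mathbb E_{z\sim D_p}\ell(x,z)$ and $f=\frac1P\sum_{p=1}^P f_p$. Assume, with $L>0$: for all $p$ and $z\in\mathrm{supp}(D_p)$ the function $\ell(\cdot,z)$ is differentiable, $\nabla\ell(\cdot,z)$ is $L$-Lipschitz and $\|\nabla\ell(\cdot,z)\|\le G$; the $f_p$ are twice differentiable and $\|\nabla^2f_p(x)-\nabla^2f_{p'}(x)\|\le\zeta$ for all $p,p',x$; $f$ has a global minimizer $x_*$. **Algorithm (BVR-L-PSGD).** Inputs: $\tilde x_0\in\mathbb R^d$, $\eta>0$, $r>0$, integers $b,K,T,S\ge1$. Put $I(k,t,s)=k+Kt+KTs$ and $b_k=\lceil\sqrt K\rceil b$ if $\lceil\sqrt K\rceil\mid k$, $b_k=b$ otherwise. All perturbations $\xi_i$ ($i\ge-1$) are uniform on the ball $\{\|x\|\le r\}$, all random choices are independent, and $x_0=\tilde x_0+\eta\xi_{-1}$. For $s<S$, $t<T$: with $i=I(0,t,s)$, every worker $p$ sets $v_i^{(p)}=\nabla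 f_p(x_i)$ if $t=0$, and $v_i^{(p)}=\frac1{Kb}\sum_{l\le Kb}(\nabla\ell(x_i,z_l)-\nabla\ell(x_{i-K},z_l))+v_{i-K}^{(p)}$ with fresh i.i.d. $z_l\sim D_p$ if $t\ge1$; put $v_i=\frac1P\sum_pv_i^{(p)}$ and choose $p_{t,s}$ uniformly from $\{1,\dots,P\}$. For $1\le k<K$ and $i=I(k,t,s)$, $v_i=\frac1{b_k}\sum_{l\le b_k}(\nabla\ell(x_i,z_l)-\nabla\ell(x_{i-1},z_l))+v_{i-1}$ with fresh i.i.d. $z_l\sim D_{p_{t,s}}$. For every $i<KTS$, $\tilde x_{i+1}=x_i-\eta v_i$ and $x_{i+1}=\tilde x_{i+1}+\eta\xi_i$. There is one communication at the start of each stage $s$ and two in each round $(t,s)$. **Statement.** There are universal constants $c,c_r,C,C'>0$ such that the following holds in this setting, for all $b,K,T\ge1$, $q\in(0,1)$, $\varepsilon>0$ and $\tilde x_0$. Put $$\eta_{\max}(S)=c\,\Big(\tfrac1L\wedge\tfrac1{K\zeta}\wedge\tfrac{\sqrt{b/K}}{L}\wedge\tfrac{\sqrt{Pb}}{\sqrt{KT}\,L}\Big)\Big/\sqrt{\log\tfrac{e\,KTS(1+G/\varepsilon)}{q}}$$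 (with $1/(K\zeta)=\infty$ if $\zeta=0$). 1. Let $S\ge1$, $0<\eta\le\eta_{\max}(S)$ and $0<r\le c_r\varepsilon$. If $S\ge C\,\frac{f(\tilde x_0)-f(x_*)}{\eta KT\varepsilon^2}$, then with probability at least $1-3q$ there is $i\in\{0,\dots,KTS-1\}$ with $\|\nabla f(\tilde x_i)\|\le\varepsilon$. The same holds with the random value $f(x_0)$ in place of $f(\tilde x_0)$: with probability at least $1-3q$, the inequality $S\ge C\,\frac{f(x_0)-f(x_*)}{\eta KT\varepsilon^2}$ implies that there is such an $i$. 2. There is an $S\ge1$ that satisfies $S\ge C\,\frac{f(\tilde x_0)-f(x_*)}{\eta KT\varepsilon^2}$ with $\eta=\eta_{\max}(S)$ and for which the number $S(1+2T)$ of communications is at most $$C'\Big(T+M\sqrt{\log\tfrac{e\,KT(1+G/\varepsilon)(1+M)}{q}}\Big),\qquad M=\Big(\tfrac LK+\zeta+\tfrac L{\sqrt{Kb}}+\tfrac{\sqrt T\,L}{\sqrt{KPb}}\Big)\frac{f(\tilde x_0)-f(x_*)}{\varepsilon^2}.$$ -/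

import Mathlib

open MeasureTheory ProbabilityTheory

noncomputable section

namespace BVRLPSGD

/-- The parameter space `ℝ^d` with its Euclidean norm. -/
abbrev E (d : ℕ) : Type := EuclideanSpace ℝ (Fin d)

/-- A distributed finite-data problem: a loss `ℓ(x, z)` and, for each of the `P` workers `p`,
a data distribution `D p`. -/
structure Problem (d P : ℕ) (Z : Type*) where
  loss : E d → Z → ℝ
  D : Fin P → PMF Z

namespace Problem

variable {d P : ℕ} {Z : Type*}

/-- The stochastic gradient `∇ℓ(x, z)`, the gradient being taken in `x`. -/
def gradLoss (pb : Problem d P Z) (x : E d) (z : Z) : E d :=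
  gradient (fun y => pb.loss y z) x

/-- The local objective `f_p(x) = 𝔼_{z ∼ D_p} ℓ(x, z)`. -/
def localObj [MeasurableSpace Z] (pb : Problem d P Z) (p : Fin P) (x : E d) : ℝ :=
  ∫ z, pb.loss x z ∂(pb.D p).toMeasure

/-- The global objective `f(x) = (1/P) ∑_p f_p(x)`. -/
def obj [MeasurableSpace Z] (pb : Problem d P Z) (x : E d) : ℝ :=
  (1 / (P : ℝ)) * ∑ p, pb.localObj p x

/-- The standing assumptions on the problem. -/
structure Assumptions [MeasurableSpace Z] (pb : Problem d P Z) (L G ζ : ℝ) (xstar : E d) :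
    Prop where
  /-- offline setting: every data distribution has finite support -/
  finite_support : ∀ p, (pb.D p).support.Finite
  /-- `ℓ(·, z)` is differentiable with `L`-Lipschitz gradient, for all data points `z` -/
  differentiable_loss : ∀ p, ∀ z ∈ (pb.D p).support, Differentiable ℝ (fun x => pb.loss x z)
  lipschitz_grad : ∀ p, ∀ z ∈ (pb.D p).support, ∀ x y,
    ‖pb.gradLoss x z - pb.gradLoss y z‖ ≤ L * ‖x - y‖
  /-- the stochastic gradients are bounded by `G` -/
  bounded_grad : ∀ p, ∀ z ∈ (pb.D p).support, ∀ x, ‖pb.gradLoss x z‖ ≤ G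
  /-- the local objectives are twice differentiable with second-order heterogeneity `ζ` -/
  twice_differentiable : ∀ p, Differentiable ℝ (gradient (pb.localObj p))
  heterogeneity : ∀ p p' x,
    ‖fderiv ℝ (gradient (pb.localObj p)) x - fderiv ℝ (gradient (pb.localObj p')) x‖ ≤ ζ
  /-- `xstar` is a global minimizer of the objective -/
  minimizer : ∀ x, pb.obj xstar ≤ pb.obj x

end Problem

/-- The parameters of the algorithm that a single run needs: step size `η`, minibatch size `b`,
number `K` of local steps and number `T` of rounds per stage. -/
structure Params where
  η : ℝ
  b : ℕ
  K : ℕ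
  T : ℕ

/-- `b_k = ⌈√K⌉ b` if `k ≡ 0 (mod ⌈√K⌉)`, and `b_k = b` otherwise. -/
def Params.batch (A : Params) (k : ℕ) : ℕ :=
  if k % ⌈Real.sqrt A.K⌉₊ = 0 then ⌈Real.sqrt A.K⌉₊ * A.b else A.b

/-- One outcome of all the random draws of the algorithm.
* `ξ 0` is the initial perturbation `ξ_{-1}` and `ξ (i + 1)` is `ξ_i`.
* `worker (t + T s)` is the selected worker `p_{t,s}`.
* `z p i l` is the `l`-th sample that worker `p` draws from `D_p` at iteration `i`, if it has to
  draw one; thus the samples of the selected worker `p_{t,s}` are `z p_{t,s} i l`. -/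
structure Tape (d P : ℕ) (Z : Type*) where
  ξ : ℕ → E d
  worker : ℕ → Fin P
  z : Fin P → ℕ → ℕ → Z

/-- What the algorithm remembers when it reaches iteration `i = I(k, t, s) = k + K t + K T s`. -/
structure State (d P : ℕ) where
  /-- the unperturbed iterate `x̃_i` -/
  xt : E d
  /-- the iterate `x_i` -/
  x : E d
  /-- the previous iterate `x_{i-1}` -/
  xprev : E d
  /-- the previous estimator `v_{i-1}` -/
  v : E d
  /-- the point at which the latest round started -/
  xround : E d
  /-- the estimators `v^{(p)}` of the workers at the start of the latest round -/
  vround : Fin P → E d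

section Run

variable {d P : ℕ} {Z : Type*} [MeasurableSpace Z]

/-- `(1/m) ∑_{l<m} (∇ℓ(x, z_l) - ∇ℓ(y, z_l))`, that is `g - g^ref` for a minibatch of size `m`. -/
def gradDiff (pb : Problem d P Z) (m : ℕ) (z : ℕ → Z) (x y : E d) : E d :=
  (1 / (m : ℝ)) • ∑ l ∈ Finset.range m, (pb.gradLoss x (z l) - pb.gradLoss y (z l))

/-- The estimators `v^{(p)}_{I(0,t,s)}` of the workers at the start of a round, `i = I(0,t,s)`. -/
def roundEstimator (pb : Problem d P Z) (A : Params) (τ : Tape d P Z) (i : ℕ) (st : State d P)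
    (p : Fin P) : E d :=
  if (i / A.K) % A.T = 0 then gradient (pb.localObj p) st.x
  else gradDiff pb (A.K * A.b) (τ.z p i) st.x st.xround + st.vround p

/-- The estimator `v_i` for `i = I(k,t,s)`, `k < K`. -/
def estimator (pb : Problem d P Z) (A : Params) (τ : Tape d P Z) (i : ℕ) (st : State d P) : E d :=
  if i % A.K = 0 then (1 / (P : ℝ)) • ∑ p, roundEstimator pb A τ i st p
  else gradDiff pb (A.batch (i % A.K)) (τ.z (τ.worker (i / A.K)) i) st.x st.xprev + st.v

/-- Iteration `i` of the algorithm: `x̃_{i+1} = x_i - η v_i` and `x_{i+1} = x̃_{i+1} + η ξ_i`. -/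
def step (pb : Problem d P Z) (A : Params) (τ : Tape d P Z) (i : ℕ) (st : State d P) :
    State d P where
  xt := st.x - A.η • estimator pb A τ i st
  x := st.x - A.η • estimator pb A τ i st + A.η • τ.ξ (i + 1)
  xprev := st.x
  v := estimator pb A τ i st
  xround := if i % A.K = 0 then st.x else st.xround
  vround := if i % A.K = 0 then roundEstimator pb A τ i st else st.vround

/-- The run of the algorithm from `x̃_0 = xt0`. (The last four components of the initial state
are placeholders; iteration `0` overwrites them without reading them.) -/
def run (pb : Problem d P Z) (A : Params) (xt0 : E d) (τ : Tape d P Z) : ℕ → State d P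
  | 0 => ⟨xt0, xt0 + A.η • τ.ξ 0, xt0, 0, xt0, fun _ => 0⟩
  | i + 1 => step pb A τ i (run pb A xt0 τ i)

end Run

/-- Names of the individual random draws. -/
inductive Draw (P : ℕ)
  | ξ (i : ℕ)
  | worker (j : ℕ)
  | z (p : Fin P) (i l : ℕ)

section Random

variable {d P : ℕ} {Z Ω : Type*} [MeasurableSpace Z]

/-- The σ-algebra on the sample space that is generated by a single draw. -/
@[reducible] def drawSigma (τ : Ω → Tape d P Z) : Draw P → MeasurableSpace Ω
  | .ξ i => MeasurableSpace.comap (fun ω => (τ ω).ξ i) inferInstance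
  | .worker j => MeasurableSpace.comap (fun ω => (τ ω).worker j) inferInstance
  | .z p i l => MeasurableSpace.comap (fun ω => (τ ω).z p i l) inferInstance

/-- All draws are independent, the perturbations are uniform on the closed ball of radius `r`,
the selected workers are uniform on the set of workers, and the samples of worker `p` have
law `D p`. -/
structure IsSampling [NeZero P] [MeasurableSpace Ω] (pb : Problem d P Z) (r : ℝ)
    (μ : Measure Ω) (τ : Ω → Tape d P Z) : Prop where
  measurable_ξ : ∀ i, Measurable fun ω => (τ ω).ξ i
  measurable_worker : ∀ j, Measurable fun ω => (τ ω).worker j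
  measurable_z : ∀ p i l, Measurable fun ω => (τ ω).z p i l
  law_ξ : ∀ i, μ.map (fun ω => (τ ω).ξ i) =
    ProbabilityTheory.cond volume (Metric.closedBall (0 : E d) r)
  law_worker : ∀ j, μ.map (fun ω => (τ ω).worker j) = (PMF.uniformOfFintype (Fin P)).toMeasure
  law_z : ∀ p i l, μ.map (fun ω => (τ ω).z p i l) = (pb.D p).toMeasure
  indep : iIndep (drawSigma τ) μ

end Random

/-- `max (L, K ζ, L √(K/b), L √(K T/(P b)))`, which is the reciprocal of
`1/L ∧ 1/(K ζ) ∧ √(b/K)/L ∧ √(P b)/(√(K T) L)` (with `1/(K ζ) = ∞` if `ζ = 0`). -/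
def invStep (P b K T : ℕ) (L ζ : ℝ) : ℝ :=
  max (max L (K * ζ)) (max (L * Real.sqrt (K / b)) (L * Real.sqrt (K * T / (P * b))))

/-- The logarithmic factor `log (e K T S (1 + G/ε) / q)` in the choice of the step size. -/
def logFactor (K T S : ℕ) (G ε q : ℝ) : ℝ :=
  Real.log (Real.exp 1 * (K * T * S) * (1 + G / ε) / q)

/-- The largest step size `c (1/L ∧ 1/(K ζ) ∧ √(b/K)/L ∧ √(P b)/(√(K T) L)) / √log(…)`. -/
def maxStep (c : ℝ) (P b K T S : ℕ) (L G ζ ε q : ℝ) : ℝ :=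
  c / (invStep P b K T L ζ * Real.sqrt (logFactor K T S G ε q))

/-- The number of communications in `S` stages of `T` rounds: one at the start of each stage, and
in each round one to aggregate the estimators and one to broadcast the new iterate. -/
def commRounds (T S : ℕ) : ℕ := S * (1 + 2 * T)

/-- `(L/K + ζ + L/√(K b) + √T L/√(K P b)) Δ / ε²`. -/
def mainTerm (P b K T : ℕ) (L ζ Δ ε : ℝ) : ℝ :=
  (L / K + ζ + L / Real.sqrt (K * b) + Real.sqrt T * L / Real.sqrt (K * P * b)) * Δ / ε ^ 2

end BVRLPSGD

end

/-! Write u_i for v_i minus the perturbation that follows it, so that x_{i+1} = x_i - η u_i, and e_i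
for v_i - ∇f(x_i). Smoothness makes f decrease along N = KTS steps by about (η/2) ∑ (‖∇f(x_i)‖² +
‖u_i‖²), at a cost of η ∑ ‖e_i‖² and a small perturbation term. Once ∑ ‖e_i‖² ≤ (1/10) ∑ ‖u_i‖² + N
ε²/100, a run with all gradients at x̃_i larger than ε would lower f by at least η N ε²/4, which is
impossible for large S (`lower_bound_of_not_stationary`).

The error e_i is a sum of three terms: the sampling error of the rounds of the stage, the sampling
error of the local steps of the round, and the drift of ∇f_p - ∇f since the start of the round for
the selected worker p. Heterogeneity bounds the drift by ζ times a displacement. The sampling errors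
are vector martingales whose variance proxies V are again sums of squared displacements, hence
multiples of sums of ‖u_i‖². All three terms can thus be absorbed, and the step size is chosen to
make the coefficients small (`NoiseBounded.sum_error_sq_le`).

Since V is random and depends on the run, the concentration bound has to be stated in terms of V
itself. Convexity of cosh √s shows that exp(-V/2) cosh ‖M‖ is a supermartingale in every inner
product space, with no dependence on the dimension. Markov's inequality and a union over the integer
levels of V/ρ give ‖M‖² ≤ 2θ(V + ρ) with high probability (`IsSampling.measure_noiseSum_sq_gt_le`).
The gradient bound G makes the number of levels polynomial in the argument of the logarithm, so θ =
20 log(…) suffices, with ρ of order ε²/θ.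

For the communication count, S also occurs inside the logarithm of the step size; a choice of order
1 + M √log(a(1 + M))/T resolves this (`exists_nat_ge_mul_sqrt_log`). -/

noncomputable section

namespace BVRLPSGD

/-! ### Exponential moments of vector increments through cosh of the norm -/

section Hyperbolic

/-- `s ↦ cosh √s` is convex on `[0, ∞)`: its power series has nonnegative coefficients. -/
lemma convexOn_cosh_sqrt : ConvexOn ℝ (Set.Ici 0) fun s : ℝ => Real.cosh (Real.sqrt s) := by
  have key : ∀ s : ℝ, 0 ≤ s →
      HasSum (fun n : ℕ => s ^ n / ((2 * n).factorial : ℝ)) (Real.cosh (Real.sqrt s)) := by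
    intro s hs
    simpa [pow_mul, Real.sq_sqrt hs] using Real.hasSum_cosh (Real.sqrt s)
  refine ⟨convex_Ici 0, fun x hx y hy a b ha hb hab => ?_⟩
  have hx' : 0 ≤ x := hx
  have hy' : 0 ≤ y := hy
  have hxy : 0 ≤ a • x + b • y := by simp only [smul_eq_mul]; positivity
  refine hasSum_le (fun n => ?_) (key _ hxy)
    (((key x hx').mul_left a).add ((key y hy').mul_left b))
  have h := (convexOn_pow n).2 hx hy ha hb hab
  simp only [smul_eq_mul] at h ⊢
  calc (a * x + b * y) ^ n / ((2 * n).factorial : ℝ)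
      ≤ (a * x ^ n + b * y ^ n) / ((2 * n).factorial : ℝ) := by gcongr
    _ = _ := by ring

variable {V : Type*} [NormedAddCommGroup V] [InnerProductSpace ℝ V]

/-- With t = ⟨m, x⟩/(‖m‖σ) ∈ [-1, 1], the square ‖m + x‖² is at most the mean of (‖m‖ + σ)² and (‖m‖
- σ)² with weights (1 ± t)/2, so convexity of cosh √s applies. The bound is affine in x: averaging
over a centred x removes the last term. -/
lemma cosh_norm_add_le {m x : V} {σ : ℝ} (hσ : 0 < σ) (hm : m ≠ 0) (hx : ‖x‖ ≤ σ) :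
    Real.cosh ‖m + x‖ ≤ Real.cosh ‖m‖ * Real.cosh σ +
      inner ℝ m x * (Real.sinh ‖m‖ * Real.sinh σ / (‖m‖ * σ)) := by
  have ha : 0 < ‖m‖ := norm_pos_iff.2 hm
  set a := ‖m‖ with hadef
  set t := inner ℝ m x / (a * σ) with ht
  have haσ : 0 < a * σ := mul_pos ha hσ
  have hin : |inner ℝ m x| ≤ a * σ :=
    (abs_real_inner_le_norm m x).trans (by rw [← hadef]; gcongr)
  have ht1 : t ≤ 1 := by rw [ht, div_le_one haσ]; exact (le_abs_self _).trans hin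
  have ht2 : -1 ≤ t := by
    rw [ht, le_div_iff₀ haσ]; linarith [neg_abs_le (inner ℝ m x : ℝ)]
  have hti : inner ℝ m x = t * (a * σ) := by rw [ht]; field_simp
  have hconv := convexOn_cosh_sqrt.2 (Set.mem_Ici.2 (sq_nonneg (a + σ))) (Set.mem_Ici.2 (sq_nonneg (a - σ)))
    (show 0 ≤ (1 + t) / 2 by linarith) (show 0 ≤ (1 - t) / 2 by linarith) (by ring)
  simp only [smul_eq_mul, Real.sqrt_sq_eq_abs, Real.cosh_abs] at hconv
  have hle : ‖m + x‖ ^ 2 ≤ (1 + t) / 2 * (a + σ) ^ 2 + (1 - t) / 2 * (a - σ) ^ 2 := by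
    rw [norm_add_sq_real, hti]
    nlinarith [norm_nonneg x]
  have hmono : Real.cosh ‖m + x‖ ≤
      Real.cosh (Real.sqrt ((1 + t) / 2 * (a + σ) ^ 2 + (1 - t) / 2 * (a - σ) ^ 2)) := by
    rw [Real.cosh_le_cosh, abs_of_nonneg (norm_nonneg _), abs_of_nonneg (Real.sqrt_nonneg _)]
    exact Real.le_sqrt_of_sq_le hle
  refine hmono.trans (hconv.trans (le_of_eq ?_))
  rw [Real.cosh_add, Real.cosh_sub, hti]
  field_simp
  ring

/-- A centred, bounded, finitely supported increment multiplies `cosh ‖·‖` by at most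
`exp (σ² / 2)` in expectation, in every inner product space. -/
lemma sum_cosh_norm_add_le {Z : Type*} (s : Finset Z) (w : Z → ℝ) (hw : ∀ z ∈ s, 0 ≤ w z)
    (hw1 : ∑ z ∈ s, w z = 1) (m : V) (X : Z → V) (hX : ∑ z ∈ s, w z • X z = 0) {σ : ℝ}
    (hσ : ∀ z ∈ s, ‖X z‖ ≤ σ) :
    ∑ z ∈ s, w z * Real.cosh ‖m + X z‖ ≤ Real.cosh ‖m‖ * Real.exp (σ ^ 2 / 2) := by
  obtain ⟨z0, hz0⟩ : s.Nonempty := by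
    rw [Finset.nonempty_iff_ne_empty]; rintro rfl; simp at hw1
  have hσ0 : 0 ≤ σ := (norm_nonneg _).trans (hσ z0 hz0)
  have hcosh := Real.cosh_le_exp_half_sq σ
  -- The slope of the affine bound has denominator ‖m‖σ, so m = 0 and σ = 0 are treated separately.
  by_cases hm : m = 0
  · subst hm
    simp only [zero_add, norm_zero, Real.cosh_zero, one_mul]
    refine le_trans ?_ hcosh
    calc ∑ z ∈ s, w z * Real.cosh ‖X z‖ ≤ ∑ z ∈ s, w z * Real.cosh σ := by
          refine Finset.sum_le_sum fun z hz => mul_le_mul_of_nonneg_left ?_ (hw z hz)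
          rw [Real.cosh_le_cosh, abs_of_nonneg (norm_nonneg _), abs_of_nonneg hσ0]
          exact hσ z hz
      _ = Real.cosh σ := by rw [← Finset.sum_mul, hw1, one_mul]
  rcases hσ0.eq_or_lt with h0 | hpos
  · have : ∀ z ∈ s, w z * Real.cosh ‖m + X z‖ = w z * Real.cosh ‖m‖ := by
      intro z hz
      have : X z = 0 := norm_le_zero_iff.1 (by rw [h0]; exact hσ z hz)
      rw [this, add_zero]
    rw [Finset.sum_congr rfl this, ← Finset.sum_mul, hw1, one_mul, ← h0]
    simp
  set c := Real.sinh ‖m‖ * Real.sinh σ / (‖m‖ * σ)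
  calc ∑ z ∈ s, w z * Real.cosh ‖m + X z‖
      ≤ ∑ z ∈ s, w z * (Real.cosh ‖m‖ * Real.cosh σ + inner ℝ m (X z) * c) :=
        Finset.sum_le_sum fun z hz =>
          mul_le_mul_of_nonneg_left (cosh_norm_add_le hpos hm (hσ z hz)) (hw z hz)
    _ = (∑ z ∈ s, w z) * (Real.cosh ‖m‖ * Real.cosh σ) + inner ℝ m (∑ z ∈ s, w z • X z) * c := by
        rw [inner_sum, Finset.sum_mul, Finset.sum_mul, ← Finset.sum_add_distrib]
        refine Finset.sum_congr rfl fun z _ => ?_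
        rw [inner_smul_right]; ring
    _ = Real.cosh ‖m‖ * Real.cosh σ := by rw [hX, hw1]; simp
    _ ≤ _ := mul_le_mul_of_nonneg_left hcosh (Real.cosh_pos _).le

end Hyperbolic

/-! ### The descent inequality -/

section Smooth

variable {d : ℕ}

/-- The quadratic upper bound for a function with Lipschitz gradient. -/
lemma le_quadratic_of_lipschitz_gradient {f : E d → ℝ} {L : ℝ} (hf : Differentiable ℝ f)
    (hL : ∀ x y, ‖gradient f x - gradient f y‖ ≤ L * ‖x - y‖) (x h : E d) :
    f (x + h) ≤ f x + inner ℝ (gradient f x) h + L / 2 * ‖h‖ ^ 2 := by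
  have hline : ∀ t : ℝ, HasDerivAt (fun t : ℝ => f (x + t • h))
      (inner ℝ (gradient f (x + t • h)) h) t := by
    intro t
    have h1 : HasFDerivAt f (InnerProductSpace.toDual ℝ (E d) (gradient f (x + t • h)))
        (x + t • h) := (hf _).hasGradientAt.hasFDerivAt
    have h2 : HasDerivAt (fun t : ℝ => x + t • h) h t := by
      simpa using ((hasDerivAt_id t).smul_const h).const_add x
    simpa [Function.comp_def] using h1.comp_hasDerivAt t h2
  let g : ℝ → ℝ := fun t => f (x + t • h) - t * inner ℝ (gradient f x) h - L / 2 * ‖h‖ ^ 2 * t ^ 2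
  have hg : ∀ t : ℝ, HasDerivAt g (inner ℝ (gradient f (x + t • h)) h - inner ℝ (gradient f x) h
      - L / 2 * ‖h‖ ^ 2 * (2 * t)) t := by
    intro t
    have h3 : HasDerivAt (fun t : ℝ => t * inner ℝ (gradient f x) h)
        (inner ℝ (gradient f x) h) t := by
      simpa using (hasDerivAt_id t).mul_const (inner ℝ (gradient f x) h : ℝ)
    have h4 : HasDerivAt (fun t : ℝ => L / 2 * ‖h‖ ^ 2 * t ^ 2) (L / 2 * ‖h‖ ^ 2 * (2 * t)) t := by
      simpa using (hasDerivAt_pow 2 t).const_mul (L / 2 * ‖h‖ ^ 2)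
    exact ((hline t).sub h3).sub h4
  have hanti : AntitoneOn g (Set.Icc 0 1) := by
    refine antitoneOn_of_deriv_nonpos (convex_Icc 0 1)
      (fun t _ => (hg t).continuousAt.continuousWithinAt)
      (fun t _ => (hg t).differentiableAt.differentiableWithinAt) fun t ht => ?_
    rw [interior_Icc] at ht
    rw [(hg t).deriv, ← inner_sub_left]
    have h5 := real_inner_le_norm (gradient f (x + t • h) - gradient f x) h
    have h6 := hL (x + t • h) x
    rw [add_sub_cancel_left, norm_smul, Real.norm_of_nonneg ht.1.le] at h6
    nlinarith [mul_le_mul_of_nonneg_right h6 (norm_nonneg h)]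
  have := hanti (Set.left_mem_Icc.2 zero_le_one) (Set.right_mem_Icc.2 zero_le_one) zero_le_one
  simp only [g, one_smul, zero_smul, add_zero] at this
  linarith

end Smooth

/-! ### Adding one independent sample -/

section Concentration

variable {d P : ℕ} {Z Ω : Type*}

/-- The mean of a finitely supported distribution. -/
def supportMean (D : PMF Z) (hD : D.support.Finite) (φ : Z → E d) : E d :=
  ∑ z ∈ hD.toFinset, (D z).toReal • φ z

lemma sum_toReal_support (D : PMF Z) (hD : D.support.Finite) :
    ∑ z ∈ hD.toFinset, (D z).toReal = 1 := by
  rw [← ENNReal.toReal_sum fun z _ => D.apply_ne_top z]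
  have h := D.tsum_coe
  rw [tsum_eq_sum (s := hD.toFinset) (by intro z hz; simpa using hz)] at h
  rw [h]; rfl

lemma measurable_supportMean {F : MeasurableSpace Ω} (D : PMF Z) (hD : D.support.Finite)
    {φ : Ω → Z → E d} (hφ : ∀ z ∈ D.support, Measurable fun ω => φ ω z) :
    Measurable fun ω => supportMean D hD (φ ω) := by
  unfold supportMean
  refine Finset.measurable_fun_sum _ fun z hz => ?_
  have := hφ z (by simpa using hz)
  fun_prop

lemma measurable_ofReal_cosh_norm {F : MeasurableSpace Ω} {A : Ω → E d} (hA : Measurable A) :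
    Measurable fun ω => ENNReal.ofReal (Real.cosh ‖A ω‖) :=
  (Real.measurable_cosh.comp hA.norm).ennreal_ofReal

variable [MeasurableSpace Z]

/-- As the sample takes finitely many values and is independent of F, splitting the integral by its
value replaces each indicator by the mass D z; the finite inequality for cosh then applies
pointwise. The weight W plays the role of conditioning: it later carries exponential factors and the
indicator of an event of the past. -/
lemma lintegral_cosh_add_sample_le [MeasurableSingletonClass Z] {F mΩ : MeasurableSpace Ω}
    {μ : Measure Ω} (hF : F ≤ mΩ) {smp : Ω → Z} (hsmp : Measurable smp)
    (hind : Indep F (MeasurableSpace.comap smp inferInstance) μ) (D : PMF Z)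
    (hD : D.support.Finite) (hlaw : μ.map smp = D.toMeasure) (hsupp : ∀ ω, smp ω ∈ D.support)
    {W : Ω → ENNReal} {A : Ω → E d} {φ : Ω → Z → E d} {σ : Ω → ℝ}
    (hW : Measurable[F] W) (hA : Measurable[F] A)
    (hφ : ∀ z ∈ D.support, Measurable[F] fun ω => φ ω z)
    (hσ : ∀ ω, ∀ z ∈ D.support, ‖φ ω z - supportMean D hD (φ ω)‖ ≤ σ ω) :
    ∫⁻ ω, W ω * ENNReal.ofReal
        (Real.cosh ‖A ω + (φ ω (smp ω) - supportMean D hD (φ ω))‖) ∂μ ≤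
      ∫⁻ ω, W ω * ENNReal.ofReal (Real.exp (σ ω ^ 2 / 2)) *
        ENNReal.ofReal (Real.cosh ‖A ω‖) ∂μ := by
  classical
  set s := hD.toFinset
  have hmean : Measurable[F] fun ω => supportMean D hD (φ ω) :=
    measurable_supportMean D hD hφ
  let g : Z → Ω → ENNReal := fun z ω =>
    W ω * ENNReal.ofReal (Real.cosh ‖A ω + (φ ω z - supportMean D hD (φ ω))‖)
  have hg : ∀ z ∈ s, Measurable[F] (g z) := fun z hz => hW.mul
    (measurable_ofReal_cosh_norm (hA.add ((hφ z (by simpa [s] using hz)).sub hmean)))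
  have hT : ∀ z, MeasurableSet (smp ⁻¹' {z}) := fun z => hsmp (measurableSet_singleton z)
  have hmass : ∀ z, μ (smp ⁻¹' {z}) = D z := fun z => by
    rw [← Measure.map_apply hsmp (measurableSet_singleton z), hlaw,
      PMF.toMeasure_apply_singleton _ _ (measurableSet_singleton z)]
  calc ∫⁻ ω, W ω * ENNReal.ofReal
        (Real.cosh ‖A ω + (φ ω (smp ω) - supportMean D hD (φ ω))‖) ∂μ
      = ∫⁻ ω, ∑ z ∈ s, g z ω * (smp ⁻¹' {z}).indicator (fun _ => 1) ω ∂μ := by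
        refine lintegral_congr fun ω => ?_
        rw [Finset.sum_eq_single (smp ω)]
        · simp [g]
        · intro z _ hz
          rw [Set.indicator_of_notMem (by simpa using hz.symm), mul_zero]
        · intro h; exact absurd (by simpa [s] using hsupp ω) h
    _ = ∑ z ∈ s, ∫⁻ ω, g z ω * (smp ⁻¹' {z}).indicator (fun _ => 1) ω ∂μ :=
        lintegral_finsetSum _ fun z hz =>
          ((hg z hz).mono hF le_rfl).mul (measurable_const.indicator (hT z))
    _ = ∑ z ∈ s, ∫⁻ ω, D z * g z ω ∂μ := by
        refine Finset.sum_congr rfl fun z hz => ?_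
        rw [lintegral_mul_indicator_eq_lintegral_mul_lintegral_indicator hF 1 (hT z) ?_ (hg z hz),
          lintegral_indicator_const (hT z), one_mul, hmass,
          lintegral_const_mul _ ((hg z hz).mono hF le_rfl), mul_comm]
        exact indepSets_of_indepSets_of_le_right ((Indep_iff_IndepSets _ _ _).1 hind)
          (Set.singleton_subset_iff.2 ⟨{z}, measurableSet_singleton z, rfl⟩)
    _ = ∫⁻ ω, ∑ z ∈ s, D z * g z ω ∂μ := (lintegral_finsetSum _ fun z hz =>
          ((hg z hz).mono hF le_rfl).const_mul _).symm
    _ ≤ _ := by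
        refine lintegral_mono fun ω => ?_
        have h := sum_cosh_norm_add_le s (fun z => (D z).toReal) (fun _ _ => ENNReal.toReal_nonneg)
          (sum_toReal_support D hD) (A ω) (fun z => φ ω z - supportMean D hD (φ ω)) (by
            simp only [smul_sub, Finset.sum_sub_distrib, ← Finset.sum_smul]
            rw [sum_toReal_support D hD, one_smul, supportMean, sub_self])
          (fun z hz => hσ ω z (by simpa [s] using hz))
        calc ∑ z ∈ s, D z * g z ω
            = W ω * ENNReal.ofReal (∑ z ∈ s, (D z).toReal *
                Real.cosh ‖A ω + (φ ω z - supportMean D hD (φ ω))‖) := by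
              rw [ENNReal.ofReal_sum_of_nonneg fun z _ =>
                mul_nonneg ENNReal.toReal_nonneg (Real.cosh_pos _).le, Finset.mul_sum]
              refine Finset.sum_congr rfl fun z _ => ?_
              rw [ENNReal.ofReal_mul ENNReal.toReal_nonneg, ENNReal.ofReal_toReal (D.apply_ne_top z)]
              simp only [g]; ring
          _ ≤ W ω * ENNReal.ofReal (Real.cosh ‖A ω‖ * Real.exp (σ ω ^ 2 / 2)) := by
              gcongr
          _ = _ := by
              rw [ENNReal.ofReal_mul (Real.cosh_pos _).le]; ring

end Concentration

/-! ### The filtration of the draws and one block of samples -/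

section History

variable {d P : ℕ} {Z Ω : Type*} [MeasurableSpace Z]

lemma measurable_eval_of_finite_range {F : MeasurableSpace Ω} [MeasurableSingletonClass Z]
    {smp : Ω → Z} (hsmp : Measurable smp) {s : Set Z} (hs : s.Finite) (hmem : ∀ ω, smp ω ∈ s)
    {φ : Ω → Z → E d} (hφ : ∀ z ∈ s, Measurable fun ω => φ ω z) :
    Measurable fun ω => φ ω (smp ω) := by
  classical
  have h : (fun ω => φ ω (smp ω)) =
      fun ω => ∑ z ∈ hs.toFinset, (smp ⁻¹' {z}).indicator (fun ω => φ ω z) ω := by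
    funext ω
    rw [Finset.sum_eq_single (smp ω)]
    · simp
    · intro z _ hz
      rw [Set.indicator_of_notMem (by simpa using hz.symm)]
    · intro h; exact absurd (by simpa using hmem ω) h
  rw [h]
  exact Finset.measurable_fun_sum _ fun z hz =>
    (hφ z (by simpa using hz)).indicator (hsmp (measurableSet_singleton z))

/-- The σ-algebra generated by a set of draws. -/
@[reducible] def sigmaOf (τ : Ω → Tape d P Z) (S : Set (Draw P)) : MeasurableSpace Ω :=
  ⨆ a ∈ S, drawSigma τ a

lemma sigmaOf_mono (τ : Ω → Tape d P Z) {S S' : Set (Draw P)} (h : S ⊆ S') :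
    sigmaOf τ S ≤ sigmaOf τ S' := biSup_mono h

lemma drawSigma_le_sigmaOf (τ : Ω → Tape d P Z) {S : Set (Draw P)} {a : Draw P} (h : a ∈ S) :
    drawSigma τ a ≤ sigmaOf τ S := le_biSup (drawSigma τ) h

/-- The draws that are made before the minibatches of iteration `i`, together with all
perturbations and all choices of workers. -/
def past (P i : ℕ) : Set (Draw P) := {a | ∀ p j l, a = Draw.z p j l → j < i}

lemma past_mono {i j : ℕ} (h : i ≤ j) : past P i ⊆ past P j :=
  fun _ ha p k l e => (ha p k l e).trans_le h

/-- The information that is available before the minibatches of iteration `i` are drawn. -/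
@[reducible] def history (τ : Ω → Tape d P Z) (i : ℕ) : MeasurableSpace Ω := sigmaOf τ (past P i)

lemma history_mono (τ : Ω → Tape d P Z) {i j : ℕ} (h : i ≤ j) : history τ i ≤ history τ j :=
  sigmaOf_mono τ (past_mono h)

lemma measurable_ξ_history (τ : Ω → Tape d P Z) (i j : ℕ) :
    Measurable[history τ i] fun ω => (τ ω).ξ j :=
  Measurable.mono (comap_measurable _)
    (drawSigma_le_sigmaOf τ (a := Draw.ξ j) (by intro p k l e; cases e)) le_rfl

lemma measurable_worker_history (τ : Ω → Tape d P Z) (i j : ℕ) :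
    Measurable[history τ i] fun ω => (τ ω).worker j :=
  Measurable.mono (comap_measurable _)
    (drawSigma_le_sigmaOf τ (a := Draw.worker j) (by intro p k l e; cases e)) le_rfl

lemma measurable_z_sigmaOf (τ : Ω → Tape d P Z) {S : Set (Draw P)} {p : Fin P} {j l : ℕ}
    (h : Draw.z p j l ∈ S) : Measurable[sigmaOf τ S] fun ω => (τ ω).z p j l :=
  Measurable.mono (comap_measurable _) (drawSigma_le_sigmaOf τ h) le_rfl

lemma measurable_z_history (τ : Ω → Tape d P Z) {i j : ℕ} (h : j < i) (p : Fin P) (l : ℕ) :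
    Measurable[history τ i] fun ω => (τ ω).z p j l :=
  measurable_z_sigmaOf τ (by intro p k l e; cases e; exact h)

variable {pb : Problem d P Z} {τ : Ω → Tape d P Z}

/-- The centred contribution of a family `B` of samples of iteration `i`. -/
def blockNoise (pb : Problem d P Z) (hD : ∀ p, (pb.D p).support.Finite) (τ : Ω → Tape d P Z)
    (i : ℕ) (B : Finset (Fin P × ℕ)) (φ : Fin P → Ω → Z → E d) (ω : Ω) : E d :=
  ∑ b ∈ B, (φ b.1 ω ((τ ω).z b.1 i b.2) - supportMean (pb.D b.1) (hD b.1) (φ b.1 ω))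

lemma measurable_blockNoise [MeasurableSingletonClass Z] {hD : ∀ p, (pb.D p).support.Finite}
    (hsupp : ∀ ω p i l, (τ ω).z p i l ∈ (pb.D p).support) {S : Set (Draw P)} {i : ℕ}
    {B : Finset (Fin P × ℕ)} (hB : ∀ b ∈ B, Draw.z b.1 i b.2 ∈ S) {φ : Fin P → Ω → Z → E d}
    (hφ : ∀ p, ∀ z ∈ (pb.D p).support, Measurable[sigmaOf τ S] fun ω => φ p ω z) :
    Measurable[sigmaOf τ S] (blockNoise pb hD τ i B φ) := by
  unfold blockNoise
  refine Finset.measurable_fun_sum _ fun b hb => Measurable.sub ?_ ?_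
  · exact measurable_eval_of_finite_range (measurable_z_sigmaOf τ (hB b hb)) (hD b.1)
      (fun ω => hsupp ω _ _ _) (hφ b.1)
  · exact measurable_supportMean _ _ (hφ b.1)

variable [NeZero P] [mΩ : MeasurableSpace Ω] {r : ℝ} {μ : Measure Ω}

lemma IsSampling.drawSigma_le (hS : IsSampling pb r μ τ) (a : Draw P) : drawSigma τ a ≤ mΩ := by
  cases a with
  | ξ i => exact (hS.measurable_ξ i).comap_le
  | worker j => exact (hS.measurable_worker j).comap_le
  | z p i l => exact (hS.measurable_z p i l).comap_le

lemma IsSampling.sigmaOf_le (hS : IsSampling pb r μ τ) (S : Set (Draw P)) : sigmaOf τ S ≤ mΩ :=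
  iSup₂_le fun a _ => hS.drawSigma_le a

lemma IsSampling.indep_sigmaOf (hS : IsSampling pb r μ τ) {S : Set (Draw P)} {p : Fin P}
    {i l : ℕ} (h : Draw.z p i l ∉ S) :
    Indep (sigmaOf τ S) (MeasurableSpace.comap (fun ω => (τ ω).z p i l) inferInstance) μ := by
  have := indep_iSup_of_disjoint hS.drawSigma_le hS.indep (Set.disjoint_singleton_right.2 h)
  exact indep_of_indep_of_le_right this (le_biSup (drawSigma τ) (Set.mem_singleton (Draw.z p i l)))

variable [MeasurableSingletonClass Z]

/-- The samples are added one at a time, each independent of S and of those already added. The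
weight is quantified inside the induction because every sample moves a factor exp(σ²/2) into it. -/
lemma IsSampling.lintegral_cosh_add_blockNoise_le (hS : IsSampling pb r μ τ)
    (hD : ∀ p, (pb.D p).support.Finite) (hsupp : ∀ ω p i l, (τ ω).z p i l ∈ (pb.D p).support)
    {S : Set (Draw P)} {i : ℕ} {A : Ω → E d} {φ : Fin P → Ω → Z → E d} {σ : Ω → ℝ}
    (hA : Measurable[sigmaOf τ S] A)
    (hφ : ∀ p, ∀ z ∈ (pb.D p).support, Measurable[sigmaOf τ S] fun ω => φ p ω z)
    (hσm : Measurable[sigmaOf τ S] σ)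
    (hσ : ∀ p ω, ∀ z ∈ (pb.D p).support,
      ‖φ p ω z - supportMean (pb.D p) (hD p) (φ p ω)‖ ≤ σ ω)
    (B : Finset (Fin P × ℕ)) (hB : ∀ b ∈ B, Draw.z b.1 i b.2 ∉ S) :
    ∀ W : Ω → ENNReal, Measurable[sigmaOf τ S] W →
      ∫⁻ ω, W ω * ENNReal.ofReal (Real.cosh ‖A ω + blockNoise pb hD τ i B φ ω‖) ∂μ ≤
      ∫⁻ ω, W ω * ENNReal.ofReal (Real.exp (B.card * (σ ω ^ 2 / 2))) *
        ENNReal.ofReal (Real.cosh ‖A ω‖) ∂μ := by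
  classical
  induction B using Finset.induction_on with
  | empty => intro W hW; simp [blockNoise]
  | insert b B hb ih =>
    intro W hW
    let S' : Set (Draw P) := S ∪ (fun b => Draw.z b.1 i b.2) '' (B : Set (Fin P × ℕ))
    have hSS' : S ⊆ S' := Set.subset_union_left
    have hle := sigmaOf_mono τ hSS'
    have hnot : Draw.z b.1 i b.2 ∉ S' := by
      rintro (h | ⟨b', hb', h⟩)
      · exact hB b (Finset.mem_insert_self _ _) h
      · simp only [Draw.z.injEq, true_and] at h
        exact hb (by rwa [← Prod.ext h.1 h.2])
    have hA' : Measurable[sigmaOf τ S'] fun ω => A ω + blockNoise pb hD τ i B φ ω :=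
      (hA.mono hle le_rfl).add (measurable_blockNoise hsupp
        (fun b hb => Or.inr ⟨b, hb, rfl⟩) fun p z hz => (hφ p z hz).mono hle le_rfl)
    have hW' : Measurable[sigmaOf τ S] fun ω => W ω * ENNReal.ofReal (Real.exp (σ ω ^ 2 / 2)) := by
      have := hW; fun_prop
    calc ∫⁻ ω, W ω * ENNReal.ofReal
          (Real.cosh ‖A ω + blockNoise pb hD τ i (insert b B) φ ω‖) ∂μ
        = ∫⁻ ω, W ω * ENNReal.ofReal (Real.cosh ‖(A ω + blockNoise pb hD τ i B φ ω) +
            (φ b.1 ω ((τ ω).z b.1 i b.2) - supportMean (pb.D b.1) (hD b.1) (φ b.1 ω))‖) ∂μ := by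
          refine lintegral_congr fun ω => ?_
          rw [blockNoise, Finset.sum_insert hb, blockNoise]
          congr 4
          abel
      _ ≤ ∫⁻ ω, W ω * ENNReal.ofReal (Real.exp (σ ω ^ 2 / 2)) *
            ENNReal.ofReal (Real.cosh ‖A ω + blockNoise pb hD τ i B φ ω‖) ∂μ :=
          lintegral_cosh_add_sample_le (hS.sigmaOf_le S') (hS.measurable_z _ _ _)
            (hS.indep_sigmaOf hnot) _ (hD b.1) (hS.law_z _ _ _) (fun ω => hsupp ω _ _ _)
            (hW.mono hle le_rfl) hA' (fun z hz => (hφ _ z hz).mono hle le_rfl) (hσ b.1)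
      _ ≤ _ := ih (fun b' hb' => hB b' (Finset.mem_insert_of_mem hb')) _ hW'
      _ = _ := by
          refine lintegral_congr fun ω => ?_
          rw [Finset.card_insert_of_notMem hb, mul_assoc (W ω), ← ENNReal.ofReal_mul
            (Real.exp_pos _).le, ← Real.exp_add]
          congr 4
          push_cast; ring

end History

/-! ### Self-normalised concentration for sums of blocks -/

section Martingale

variable {d P : ℕ} {Z Ω : Type*} [MeasurableSpace Z] {pb : Problem d P Z} {τ : Ω → Tape d P Z}

/-- The sum of the centred contributions of `k` consecutive blocks of samples. -/
def noiseSum (pb : Problem d P Z) (hD : ∀ p, (pb.D p).support.Finite) (τ : Ω → Tape d P Z)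
    (n : ℕ → ℕ) (B : ℕ → Finset (Fin P × ℕ)) (φ : ℕ → Fin P → Ω → Z → E d) (k : ℕ) (ω : Ω) :
    E d :=
  ∑ j ∈ Finset.range k, blockNoise pb hD τ (n j) (B j) (φ j) ω

/-- The sum of the squared bounds of the increments of `noiseSum`. -/
def varSum (B : ℕ → Finset (Fin P × ℕ)) (σ : ℕ → Ω → ℝ) (k : ℕ) (ω : Ω) : ℝ :=
  ∑ j ∈ Finset.range k, (B j).card * σ j ω ^ 2

/-- What is assumed of the blocks of samples whose contributions are summed. -/
structure BlockData (pb : Problem d P Z) (hD : ∀ p, (pb.D p).support.Finite)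
    (τ : Ω → Tape d P Z) (n : ℕ → ℕ) (φ : ℕ → Fin P → Ω → Z → E d) (σ : ℕ → Ω → ℝ) : Prop where
  strictMono : StrictMono n
  measurable_φ : ∀ k p, ∀ z ∈ (pb.D p).support, Measurable[history τ (n k)] fun ω => φ k p ω z
  measurable_σ : ∀ k, Measurable[history τ (n k)] (σ k)
  norm_le : ∀ k p ω, ∀ z ∈ (pb.D p).support,
    ‖φ k p ω z - supportMean (pb.D p) (hD p) (φ k p ω)‖ ≤ σ k ω

variable [MeasurableSingletonClass Z] {hD : ∀ p, (pb.D p).support.Finite}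
    {n : ℕ → ℕ} {φ : ℕ → Fin P → Ω → Z → E d} {σ : ℕ → Ω → ℝ}

lemma BlockData.measurable_noiseSum (h : BlockData pb hD τ n φ σ)
    (hsupp : ∀ ω p i l, (τ ω).z p i l ∈ (pb.D p).support) (B : ℕ → Finset (Fin P × ℕ)) (k : ℕ) :
    Measurable[history τ (n k)] (noiseSum pb hD τ n B φ k) := by
  unfold noiseSum
  refine Finset.measurable_fun_sum _ fun j hj => ?_
  have hlt : n j < n k := h.strictMono (Finset.mem_range.1 hj)
  refine measurable_blockNoise hsupp (fun b _ => ?_) fun p z hz =>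
    (h.measurable_φ j p z hz).mono (history_mono τ hlt.le) le_rfl
  intro p i l e; cases e; exact hlt

omit [MeasurableSingletonClass Z] in
lemma BlockData.measurable_varSum (h : BlockData pb hD τ n φ σ)
    (B : ℕ → Finset (Fin P × ℕ)) {i k : ℕ} (hi : ∀ j < k, n j ≤ i) :
    Measurable[history τ i] (varSum B σ k) := by
  unfold varSum
  refine Finset.measurable_fun_sum _ fun j hj => ?_
  have := (h.measurable_σ j).mono (history_mono τ (hi j (Finset.mem_range.1 hj))) le_rfl
  fun_prop

variable [NeZero P] [mΩ : MeasurableSpace Ω] {r : ℝ} {μ : Measure Ω}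

/-- This is the supermartingale property of exp(-V/2) cosh ‖M‖. The term of V that belongs to a
block is known before the block is drawn, so its exponential can be put into the weight, where it
cancels the growth of cosh. -/
lemma IsSampling.lintegral_cosh_noiseSum_le (hS : IsSampling pb r μ τ)
    (h : BlockData pb hD τ n φ σ) (hsupp : ∀ ω p i l, (τ ω).z p i l ∈ (pb.D p).support)
    (B : ℕ → Finset (Fin P × ℕ)) {W : Ω → ENNReal} (hW : Measurable[history τ (n 0)] W) (k : ℕ) :
    ∫⁻ ω, W ω * ENNReal.ofReal (Real.exp (-(varSum B σ k ω / 2))) *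
      ENNReal.ofReal (Real.cosh ‖noiseSum pb hD τ n B φ k ω‖) ∂μ ≤ ∫⁻ ω, W ω ∂μ := by
  induction k with
  | zero => simp [noiseSum, varSum]
  | succ k ih =>
    have hn0 : n 0 ≤ n k := h.strictMono.monotone (Nat.zero_le k)
    have hV := h.measurable_varSum B (i := n k) (k := k + 1) fun j hj =>
      h.strictMono.monotone (Nat.lt_succ_iff.1 hj)
    have hW' : Measurable[history τ (n k)] fun ω =>
        W ω * ENNReal.ofReal (Real.exp (-(varSum B σ (k + 1) ω / 2))) := by
      have := hW.mono (history_mono τ hn0) le_rfl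
      fun_prop
    have hstep := hS.lintegral_cosh_add_blockNoise_le hD hsupp (S := past P (n k)) (i := n k)
      (h.measurable_noiseSum hsupp B k) (h.measurable_φ k) (h.measurable_σ k) (h.norm_le k) (B k)
      (fun b _ hb => lt_irrefl _ (hb _ _ _ rfl)) _ hW'
    calc _ = _ := by
          refine lintegral_congr fun ω => ?_
          rw [noiseSum, Finset.sum_range_succ, ← noiseSum]
      _ ≤ _ := hstep
      _ = _ := by
          refine lintegral_congr fun ω => ?_
          rw [mul_assoc (W ω), ← ENNReal.ofReal_mul (Real.exp_pos _).le, ← Real.exp_add, varSum,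
            Finset.sum_range_succ, ← varSum]
          congr 5
          ring
      _ ≤ _ := ih

omit [MeasurableSingletonClass Z] [NeZero P] mΩ in
lemma BlockData.smul (h : BlockData pb hD τ n φ σ) {c : ℝ} (hc : 0 ≤ c) :
    BlockData pb hD τ n (fun k p ω z => c • φ k p ω z) (fun k ω => c * σ k ω) where
  strictMono := h.strictMono
  measurable_φ k p z hz := by have := h.measurable_φ k p z hz; fun_prop
  measurable_σ k := by have := h.measurable_σ k; fun_prop
  norm_le k p ω z hz := by
    have : supportMean (pb.D p) (hD p) (fun z => c • φ k p ω z) =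
        c • supportMean (pb.D p) (hD p) (φ k p ω) := by
      simp only [supportMean, Finset.smul_sum]
      exact Finset.sum_congr rfl fun z _ => smul_comm _ _ _
    rw [this, ← smul_sub, norm_smul, Real.norm_of_nonneg hc]
    exact mul_le_mul_of_nonneg_left (h.norm_le k p ω z hz) hc

omit [MeasurableSpace Z] [MeasurableSingletonClass Z] [NeZero P] mΩ in
lemma noiseSum_smul (hD : ∀ p, (pb.D p).support.Finite) (c : ℝ) (B : ℕ → Finset (Fin P × ℕ))
    (k : ℕ) (ω : Ω) :
    noiseSum pb hD τ n B (fun k p ω z => c • φ k p ω z) k ω = c • noiseSum pb hD τ n B φ k ω := by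
  simp only [noiseSum, blockNoise, Finset.smul_sum, smul_sub, supportMean]
  refine Finset.sum_congr rfl fun j _ => Finset.sum_congr rfl fun b _ => ?_
  congr 1
  exact Finset.sum_congr rfl fun z _ => smul_comm _ _ _

/-- Markov's inequality for the supermartingale of the rescaled noise. The event Q of the past is
kept as a factor so that failures can be summed over the values of the selected worker. -/
lemma IsSampling.measure_noiseSum_ge_le (hS : IsSampling pb r μ τ)
    (h : BlockData pb hD τ n φ σ) (hsupp : ∀ ω p i l, (τ ω).z p i l ∈ (pb.D p).support)
    (B : ℕ → Finset (Fin P × ℕ)) {Q : Set Ω} (hQ : MeasurableSet[history τ (n 0)] Q) (k : ℕ)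
    {a v : ℝ} (ha : 0 ≤ a) (hv : 0 < v) :
    μ (Q ∩ {ω | a ≤ ‖noiseSum pb hD τ n B φ k ω‖ ∧ varSum B σ k ω ≤ v}) ≤
      ENNReal.ofReal (2 * Real.exp (-(a ^ 2 / (2 * v)))) * μ Q := by
  -- This scale minimises lam² v/2 - lam a, with minimum -a²/(2v).
  set lam := a / v with hlam
  have hlam0 : 0 ≤ lam := by positivity
  have hQm : MeasurableSet Q := hS.sigmaOf_le _ _ hQ
  have hI := hS.lintegral_cosh_noiseSum_le (h.smul hlam0) hsupp B (W := Q.indicator fun _ => 1)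
    (measurable_const.indicator hQ) k
  rw [lintegral_indicator_const hQm, one_mul] at hI
  set f : Ω → ENNReal := fun ω => (Q.indicator (fun _ => 1) ω *
    ENNReal.ofReal (Real.exp (-(varSum B (fun k ω => lam * σ k ω) k ω / 2)))) *
    ENNReal.ofReal (Real.cosh ‖noiseSum pb hD τ n B (fun k p ω z => lam • φ k p ω z) k ω‖) with hf
  have hfm : Measurable f := by
    have h1 := ((h.smul hlam0).measurable_varSum B (i := n k) (k := k) fun j hj =>
      h.strictMono.monotone hj.le).mono (hS.sigmaOf_le _) le_rfl
    have h2 := measurable_ofReal_cosh_norm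
      (((h.smul hlam0).measurable_noiseSum hsupp B k).mono (hS.sigmaOf_le _) le_rfl)
    have h3 : Measurable (Q.indicator fun _ => (1 : ENNReal)) := measurable_const.indicator hQm
    exact (h3.mul (by fun_prop)).mul h2
  -- A lower bound for the integrand on the event; the 2 comes from cosh y ≥ exp(y)/2.
  set c : ℝ := Real.exp (a ^ 2 / (2 * v)) / 2 with hc
  have hc0 : 0 < c := by positivity
  have hsub : Q ∩ {ω | a ≤ ‖noiseSum pb hD τ n B φ k ω‖ ∧ varSum B σ k ω ≤ v} ⊆
      {ω | ENNReal.ofReal c ≤ f ω} := by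
    rintro ω ⟨hω, h1, h2⟩
    have hvar : varSum B (fun k ω => lam * σ k ω) k ω = lam ^ 2 * varSum B σ k ω := by
      simp only [varSum, Finset.mul_sum]
      exact Finset.sum_congr rfl fun j _ => by ring
    simp only [Set.mem_ofPred_eq, hf, Set.indicator_of_mem hω, one_mul, hvar, noiseSum_smul,
      norm_smul, Real.norm_of_nonneg hlam0]
    rw [← ENNReal.ofReal_mul (Real.exp_pos _).le]
    refine ENNReal.ofReal_le_ofReal ?_
    have e1 : Real.exp (-(lam ^ 2 * v / 2)) ≤ Real.exp (-(lam ^ 2 * varSum B σ k ω / 2)) := by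
      gcongr
    have e2 : Real.exp (lam * a) / 2 ≤ Real.cosh (lam * ‖noiseSum pb hD τ n B φ k ω‖) := by
      rw [Real.cosh_eq]
      have : Real.exp (lam * a) ≤ Real.exp (lam * ‖noiseSum pb hD τ n B φ k ω‖) := by gcongr
      linarith [Real.exp_pos (-(lam * ‖noiseSum pb hD τ n B φ k ω‖))]
    calc c = Real.exp (-(lam ^ 2 * v / 2)) * (Real.exp (lam * a) / 2) := by
          rw [← mul_div_assoc, ← Real.exp_add, hc, hlam]
          congr 2
          field_simp
          ring
      _ ≤ _ := by gcongr
  have hM := (mul_meas_ge_le_lintegral hfm (ENNReal.ofReal c)).trans hI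
  have hcinv : ENNReal.ofReal (2 * Real.exp (-(a ^ 2 / (2 * v)))) * ENNReal.ofReal c = 1 := by
    rw [← ENNReal.ofReal_mul (by positivity), hc, Real.exp_neg]
    rw [show 2 * (Real.exp (a ^ 2 / (2 * v)))⁻¹ * (Real.exp (a ^ 2 / (2 * v)) / 2) = 1 by
      field_simp]
    simp
  calc _ ≤ μ {ω | ENNReal.ofReal c ≤ f ω} := measure_mono hsub
    _ = ENNReal.ofReal (2 * Real.exp (-(a ^ 2 / (2 * v)))) *
        (ENNReal.ofReal c * μ {ω | ENNReal.ofReal c ≤ f ω}) := by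
        rw [← mul_assoc, hcinv, one_mul]
    _ ≤ _ := by gcongr

/-- A sum of centred blocks is of the order of the square root of its variance proxy, up to the
floor `ρ²`: only a union over the `m + 1` possible integer parts of `varSum / ρ²` is needed. -/
lemma IsSampling.measure_noiseSum_sq_gt_le (hS : IsSampling pb r μ τ)
    (h : BlockData pb hD τ n φ σ) (hsupp : ∀ ω p i l, (τ ω).z p i l ∈ (pb.D p).support)
    (B : ℕ → Finset (Fin P × ℕ)) {Q : Set Ω} (hQ : MeasurableSet[history τ (n 0)] Q) (k : ℕ)
    {ρ θ : ℝ} (hρ : 0 < ρ) (hθ : 0 ≤ θ) {m : ℕ} (hm : ∀ ω, varSum B σ k ω ≤ m * ρ) :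
    μ (Q ∩ {ω | 2 * θ * (varSum B σ k ω + ρ) < ‖noiseSum pb hD τ n B φ k ω‖ ^ 2}) ≤
      ENNReal.ofReal ((m + 1) * (2 * Real.exp (-θ))) * μ Q := by
  -- The level j is the integer part of V/ρ: on it, V ≤ (j + 1)ρ ≤ V + ρ, so the random V may be
  -- replaced by a constant.
  have hsub : Q ∩ {ω | 2 * θ * (varSum B σ k ω + ρ) < ‖noiseSum pb hD τ n B φ k ω‖ ^ 2} ⊆
      ⋃ j ∈ Finset.range (m + 1), Q ∩ {ω | Real.sqrt (2 * θ * ((j + 1) * ρ)) ≤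
        ‖noiseSum pb hD τ n B φ k ω‖ ∧ varSum B σ k ω ≤ (j + 1) * ρ} := by
    rintro ω ⟨hω, h1⟩
    have hV0 : 0 ≤ varSum B σ k ω := Finset.sum_nonneg fun j _ => by positivity
    have hfl := Nat.floor_le (div_nonneg hV0 hρ.le)
    have hfl' := (Nat.lt_floor_add_one (varSum B σ k ω / ρ)).le
    rw [le_div_iff₀ hρ] at hfl
    rw [div_le_iff₀ hρ] at hfl'
    simp only [Set.mem_iUnion, Finset.mem_range, exists_prop]
    refine ⟨⌊varSum B σ k ω / ρ⌋₊, Nat.lt_succ_iff.2 ?_, hω, ?_, hfl'⟩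
    · refine Nat.floor_le_of_le ?_
      rw [div_le_iff₀ hρ]; exact hm ω
    · rw [Real.sqrt_le_left (norm_nonneg _)]
      refine le_trans ?_ h1.le
      have : (⌊varSum B σ k ω / ρ⌋₊ + 1) * ρ ≤ varSum B σ k ω + ρ := by linarith
      gcongr
  refine (measure_mono hsub).trans ((measure_biUnion_finset_le _ _).trans ?_)
  calc _ ≤ ∑ j ∈ Finset.range (m + 1), ENNReal.ofReal (2 * Real.exp (-θ)) * μ Q := by
        refine Finset.sum_le_sum fun j _ => ?_
        have hj : 0 < ((j : ℝ) + 1) * ρ := by positivity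
        refine (hS.measure_noiseSum_ge_le h hsupp B hQ k (Real.sqrt_nonneg _) hj).trans ?_
        rw [Real.sq_sqrt (by positivity)]
        rw [show 2 * θ * ((j + 1) * ρ) / (2 * ((j + 1) * ρ)) = θ by field_simp]
    _ = _ := by
        rw [Finset.sum_const, Finset.card_range, nsmul_eq_mul, ← mul_assoc,
          ENNReal.ofReal_mul (p := (m : ℝ) + 1) (by positivity), ← Nat.cast_succ,
          ENNReal.ofReal_natCast]

end Martingale

/-! ### Consequences of the assumptions on the problem -/

section ProblemFacts

variable {d P : ℕ} {Z : Type*}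

lemma norm_supportMean_le (D : PMF Z) (hD : D.support.Finite) {φ : Z → E d} {β : ℝ}
    (h : ∀ z ∈ D.support, ‖φ z‖ ≤ β) : ‖supportMean D hD φ‖ ≤ β := by
  calc ‖supportMean D hD φ‖ ≤ ∑ z ∈ hD.toFinset, (D z).toReal * β := by
        refine norm_sum_le_of_le _ fun z hz => ?_
        rw [norm_smul, Real.norm_of_nonneg ENNReal.toReal_nonneg]
        exact mul_le_mul_of_nonneg_left (h z (by simpa using hz)) ENNReal.toReal_nonneg
    _ = β := by rw [← Finset.sum_mul, sum_toReal_support, one_mul]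

lemma supportMean_sub (D : PMF Z) (hD : D.support.Finite) (φ ψ : Z → E d) :
    supportMean D hD (fun z => φ z - ψ z) = supportMean D hD φ - supportMean D hD ψ := by
  simp only [supportMean, smul_sub, Finset.sum_sub_distrib]

lemma supportMean_smul (D : PMF Z) (hD : D.support.Finite) (c : ℝ) (φ : Z → E d) :
    supportMean D hD (fun z => c • φ z) = c • supportMean D hD φ := by
  simp only [supportMean, Finset.smul_sum]
  exact Finset.sum_congr rfl fun z _ => smul_comm _ _ _

variable [MeasurableSpace Z] [MeasurableSingletonClass Z] {pb : Problem d P Z} {L G ζ : ℝ}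
  {xstar : E d}

lemma Problem.localObj_eq_sum (pb : Problem d P Z) (p : Fin P) (hD : (pb.D p).support.Finite)
    (x : E d) : pb.localObj p x = ∑ z ∈ hD.toFinset, (pb.D p z).toReal * pb.loss x z := by
  have hnull : (pb.D p).toMeasure (hD.toFinset : Set Z)ᶜ = 0 := by
    rw [PMF.toMeasure_apply_eq_zero_iff _ hD.toFinset.measurableSet.compl]
    simp [Set.disjoint_compl_right_iff_subset]
  have hae : ∀ᵐ z ∂(pb.D p).toMeasure, z ∈ (hD.toFinset : Set Z) := by
    rwa [ae_iff]
  rw [Problem.localObj, ← Measure.restrict_eq_self_of_ae_mem hae,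
    setIntegral_finset _ IntegrableOn.finset]
  refine Finset.sum_congr rfl fun z _ => ?_
  rw [measureReal_def, PMF.toMeasure_apply_singleton _ _ (measurableSet_singleton z), smul_eq_mul]

lemma Problem.Assumptions.hasGradientAt_localObj (hA : pb.Assumptions L G ζ xstar) (p : Fin P)
    (x : E d) : HasGradientAt (pb.localObj p)
      (supportMean (pb.D p) (hA.finite_support p) (pb.gradLoss x)) x := by
  have h : pb.localObj p =
      fun x => ∑ z ∈ (hA.finite_support p).toFinset, (pb.D p z).toReal * pb.loss x z :=
    funext fun x => pb.localObj_eq_sum p (hA.finite_support p) x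
  rw [h, hasGradientAt_iff_hasFDerivAt, supportMean, map_sum]
  refine HasFDerivAt.fun_sum fun z hz => ?_
  rw [map_smul]
  exact (((hA.differentiable_loss p z (by simpa using hz)) x).hasGradientAt.hasFDerivAt).const_mul _

lemma Problem.Assumptions.gradient_localObj (hA : pb.Assumptions L G ζ xstar) (p : Fin P)
    (x : E d) : gradient (pb.localObj p) x =
      supportMean (pb.D p) (hA.finite_support p) (pb.gradLoss x) :=
  (hA.hasGradientAt_localObj p x).gradient

lemma Problem.Assumptions.hasGradientAt_obj (hA : pb.Assumptions L G ζ xstar) (x : E d) :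
    HasGradientAt pb.obj ((1 / (P : ℝ)) • ∑ p, gradient (pb.localObj p) x) x := by
  have h : pb.obj = fun x => (1 / (P : ℝ)) * ∑ p, pb.localObj p x := rfl
  rw [h, hasGradientAt_iff_hasFDerivAt, map_smul, map_sum]
  refine HasFDerivAt.const_mul (HasFDerivAt.fun_sum fun p _ => ?_) _
  exact (hA.hasGradientAt_localObj p x).differentiableAt.hasGradientAt.hasFDerivAt

lemma Problem.Assumptions.gradient_obj (hA : pb.Assumptions L G ζ xstar) (x : E d) :
    gradient pb.obj x = (1 / (P : ℝ)) • ∑ p, gradient (pb.localObj p) x :=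
  (hA.hasGradientAt_obj x).gradient

-- The Lipschitz bound drives the error estimate. The cap 2G serves only to bound the variance
-- proxies for every outcome, which limits the number of levels in the union bound.
omit [MeasurableSingletonClass Z] in
lemma Problem.Assumptions.norm_gradLoss_sub_le (hA : pb.Assumptions L G ζ xstar) (p : Fin P)
    {z : Z} (hz : z ∈ (pb.D p).support) (x y : E d) :
    ‖pb.gradLoss x z - pb.gradLoss y z‖ ≤ min (L * ‖x - y‖) (2 * G) := by
  refine le_min (hA.lipschitz_grad p z hz x y) ((norm_sub_le _ _).trans ?_)
  linarith [hA.bounded_grad p z hz x, hA.bounded_grad p z hz y]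

lemma Problem.Assumptions.norm_gradient_localObj_sub_le (hA : pb.Assumptions L G ζ xstar)
    (p : Fin P) (x y : E d) :
    ‖gradient (pb.localObj p) x - gradient (pb.localObj p) y‖ ≤ min (L * ‖x - y‖) (2 * G) := by
  rw [hA.gradient_localObj, hA.gradient_localObj, ← supportMean_sub]
  exact norm_supportMean_le _ _ fun z hz => hA.norm_gradLoss_sub_le p hz x y

lemma norm_average_le [NeZero P] {g : Fin P → E d} {β : ℝ} (h : ∀ p, ‖g p‖ ≤ β) :
    ‖(1 / (P : ℝ)) • ∑ p, g p‖ ≤ β := by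
  have hP : (0 : ℝ) < P := by exact_mod_cast Nat.pos_of_ne_zero (NeZero.ne P)
  rw [norm_smul, Real.norm_of_nonneg (by positivity)]
  calc 1 / (P : ℝ) * ‖∑ p, g p‖ ≤ 1 / (P : ℝ) * ∑ _p : Fin P, β := by
        gcongr; exact norm_sum_le_of_le _ fun p _ => h p
    _ = β := by simp; field_simp

lemma Problem.Assumptions.norm_gradient_obj_sub_le [NeZero P] (hA : pb.Assumptions L G ζ xstar)
    (x y : E d) : ‖gradient pb.obj x - gradient pb.obj y‖ ≤ L * ‖x - y‖ := by
  rw [hA.gradient_obj, hA.gradient_obj, ← smul_sub, ← Finset.sum_sub_distrib]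
  exact norm_average_le fun p => (hA.norm_gradient_localObj_sub_le p x y).trans (min_le_left _ _)

omit [MeasurableSingletonClass Z] in
lemma Problem.Assumptions.G_nonneg [NeZero P] (hA : pb.Assumptions L G ζ xstar) : 0 ≤ G := by
  obtain ⟨z, hz⟩ := (pb.D 0).support_nonempty
  exact (norm_nonneg _).trans (hA.bounded_grad 0 z hz 0)

omit [MeasurableSingletonClass Z] in
lemma Problem.Assumptions.ζ_nonneg [NeZero P] (hA : pb.Assumptions L G ζ xstar) : 0 ≤ ζ := by
  simpa using hA.heterogeneity 0 0 0

/-- Second-order heterogeneity bounds the drift of `∇f_p - ∇f`. -/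
lemma Problem.Assumptions.norm_bias_le [NeZero P] (hA : pb.Assumptions L G ζ xstar) (p : Fin P)
    (x y : E d) :
    ‖(gradient (pb.localObj p) x - gradient pb.obj x) -
      (gradient (pb.localObj p) y - gradient pb.obj y)‖ ≤ ζ * ‖x - y‖ := by
  have hP : (P : ℝ) ≠ 0 := by exact_mod_cast NeZero.ne P
  -- Mean value inequality for a pair of workers; averaging over p' turns ∇f_{p'} into ∇f.
  have hdiff : ∀ p p' (x y : E d),
      ‖(gradient (pb.localObj p) x - gradient (pb.localObj p') x) -
        (gradient (pb.localObj p) y - gradient (pb.localObj p') y)‖ ≤ ζ * ‖x - y‖ := by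
    intro p p' x y
    refine convex_univ.norm_image_sub_le_of_norm_fderiv_le (𝕜 := ℝ)
      (f := fun x => gradient (pb.localObj p) x - gradient (pb.localObj p') x)
      (fun x _ => ((hA.twice_differentiable p) x).sub ((hA.twice_differentiable p') x))
      (fun x _ => ?_) (Set.mem_univ y) (Set.mem_univ x)
    rw [fderiv_fun_sub ((hA.twice_differentiable p) x) ((hA.twice_differentiable p') x)]
    exact hA.heterogeneity p p' x
  have havg : ∀ x, gradient (pb.localObj p) x - gradient pb.obj x =
      (1 / (P : ℝ)) • ∑ p', (gradient (pb.localObj p) x - gradient (pb.localObj p') x) := by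
    intro x
    rw [hA.gradient_obj, Finset.sum_sub_distrib, smul_sub, Finset.sum_const, Finset.card_univ,
      Fintype.card_fin, ← Nat.cast_smul_eq_nsmul ℝ, smul_smul, one_div, inv_mul_cancel₀ hP, one_smul]
  rw [havg, havg, ← smul_sub, ← Finset.sum_sub_distrib]
  exact norm_average_le fun p' => hdiff p p' x y

end ProblemFacts

/-! ### Recursions for the estimators -/

section RunFacts

variable {d P : ℕ} {Z : Type*} [MeasurableSpace Z]

/-- The iterate `x_i`. -/
def iterate (pb : Problem d P Z) (A : Params) (xt0 : E d) (τ : Tape d P Z) (i : ℕ) : E d :=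
  (run pb A xt0 τ i).x

/-- The estimator `v_i`. -/
def gradEst (pb : Problem d P Z) (A : Params) (xt0 : E d) (τ : Tape d P Z) (i : ℕ) : E d :=
  estimator pb A τ i (run pb A xt0 τ i)

/-- The estimator of worker `p` at the start of the `j`-th round. -/
def roundEst (pb : Problem d P Z) (A : Params) (xt0 : E d) (τ : Tape d P Z) (j : ℕ)
    (p : Fin P) : E d :=
  roundEstimator pb A τ (A.K * j) (run pb A xt0 τ (A.K * j)) p

variable {pb : Problem d P Z} {A : Params} {xt0 : E d} {τ : Tape d P Z}

lemma iterate_succ (i : ℕ) : iterate pb A xt0 τ (i + 1) =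
    iterate pb A xt0 τ i - A.η • gradEst pb A xt0 τ i + A.η • τ.ξ (i + 1) := rfl

lemma iterate_eq_xt_add (i : ℕ) :
    iterate pb A xt0 τ i = (run pb A xt0 τ i).xt + A.η • τ.ξ i := by
  cases i <;> rfl

/-- The range of k includes K - 1, that is, iteration K(j + 1): there the next round reads these
components before overwriting them. -/
lemma run_round (j k : ℕ) (hk : k < A.K) :
    (run pb A xt0 τ (A.K * j + k + 1)).xround = iterate pb A xt0 τ (A.K * j) ∧
      (run pb A xt0 τ (A.K * j + k + 1)).vround = roundEst pb A xt0 τ j := by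
  induction k with
  | zero => simp [run, step, iterate]; rfl
  | succ k ih =>
    have hmod : (A.K * j + (k + 1)) % A.K ≠ 0 := by
      rw [Nat.mul_add_mod, Nat.mod_eq_of_lt hk]; omega
    have := ih (by omega)
    rw [run, step]
    simp only [hmod, if_false]
    exact this

lemma gradEst_round (j : ℕ) :
    gradEst pb A xt0 τ (A.K * j) = (1 / (P : ℝ)) • ∑ p, roundEst pb A xt0 τ j p := by
  simp [gradEst, estimator, roundEst]

lemma roundEst_of_mod_eq_zero (hK : 0 < A.K) {j : ℕ} (hj : j % A.T = 0) (p : Fin P) :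
    roundEst pb A xt0 τ j p = gradient (pb.localObj p) (iterate pb A xt0 τ (A.K * j)) := by
  rw [roundEst, roundEstimator, Nat.mul_div_cancel_left _ hK, if_pos hj, iterate]

lemma roundEst_succ (hK : 0 < A.K) {j : ℕ} (hj : (j + 1) % A.T ≠ 0) (p : Fin P) :
    roundEst pb A xt0 τ (j + 1) p =
      gradDiff pb (A.K * A.b) (τ.z p (A.K * (j + 1))) (iterate pb A xt0 τ (A.K * (j + 1)))
        (iterate pb A xt0 τ (A.K * j)) + roundEst pb A xt0 τ j p := by
  have h := run_round (pb := pb) (A := A) (xt0 := xt0) (τ := τ) j (A.K - 1) (by omega)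
  have e : A.K * j + (A.K - 1) + 1 = A.K * (j + 1) := by rw [mul_add]; omega
  rw [e] at h
  rw [roundEst, roundEstimator, Nat.mul_div_cancel_left _ hK, if_neg hj, h.1, h.2]
  rfl

lemma gradEst_succ (j : ℕ) {k : ℕ} (hk : k + 1 < A.K) :
    gradEst pb A xt0 τ (A.K * j + (k + 1)) =
      gradDiff pb (A.batch (k + 1)) (τ.z (τ.worker j) (A.K * j + (k + 1)))
        (iterate pb A xt0 τ (A.K * j + (k + 1))) (iterate pb A xt0 τ (A.K * j + k)) +
        gradEst pb A xt0 τ (A.K * j + k) := by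
  have hmod : (A.K * j + (k + 1)) % A.K = k + 1 := by
    rw [Nat.mul_add_mod, Nat.mod_eq_of_lt hk]
  have hdiv : (A.K * j + (k + 1)) / A.K = j := by
    rw [Nat.mul_add_div (by omega), Nat.div_eq_of_lt hk, add_zero]
  rw [gradEst, estimator, hmod, hdiv, if_neg (by omega)]
  rfl

end RunFacts

/-! ### The run is adapted to the filtration -/

section RunMeasurable

variable {d P : ℕ} {Z Ω : Type*} [MeasurableSpace Z] [MeasurableSingletonClass Z]
  {pb : Problem d P Z} {L G ζ : ℝ} {xstar : E d} {τ : Ω → Tape d P Z}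

omit [MeasurableSingletonClass Z] in
lemma Problem.Assumptions.continuous_gradLoss (hA : pb.Assumptions L G ζ xstar) {p : Fin P} {z : Z}
    (hz : z ∈ (pb.D p).support) : Continuous fun x => pb.gradLoss x z := by
  refine (LipschitzWith.of_dist_le_mul (K := L.toNNReal) fun x y => ?_).continuous
  rw [dist_eq_norm, dist_eq_norm]
  refine (hA.lipschitz_grad p z hz x y).trans ?_
  gcongr
  exact Real.le_coe_toNNReal L

lemma measurable_apply_fin {F : MeasurableSpace Ω} {w : Ω → Fin P} (hw : Measurable w)
    {g : Fin P → Ω → E d} (hg : ∀ p, Measurable (g p)) : Measurable fun ω => g (w ω) ω := by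
  have h : (fun ω => g (w ω) ω) = fun ω => ∑ p, (w ⁻¹' {p}).indicator (g p) ω := by
    funext ω
    rw [Finset.sum_eq_single (w ω)]
    · simp
    · intro p _ hp
      rw [Set.indicator_of_notMem (by simpa using hp.symm)]
    · simp
  rw [h]
  exact Finset.measurable_fun_sum _ fun p _ => (hg p).indicator (hw (measurableSet_singleton p))

lemma Problem.Assumptions.measurable_gradDiff (hA : pb.Assumptions L G ζ xstar)
    (hsupp : ∀ ω p i l, (τ ω).z p i l ∈ (pb.D p).support) (m : ℕ) (p : Fin P) {i j : ℕ}
    (hij : i < j) {x y : Ω → E d} (hx : Measurable[history τ j] x)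
    (hy : Measurable[history τ j] y) :
    Measurable[history τ j] fun ω => gradDiff pb m ((τ ω).z p i) (x ω) (y ω) := by
  have : Measurable[history τ j] fun ω => ∑ l ∈ Finset.range m,
      (pb.gradLoss (x ω) ((τ ω).z p i l) - pb.gradLoss (y ω) ((τ ω).z p i l)) := by
    refine Finset.measurable_fun_sum _ fun l _ => ?_
    refine measurable_eval_of_finite_range
      (φ := fun ω z => pb.gradLoss (x ω) z - pb.gradLoss (y ω) z)
      (measurable_z_history τ hij p l) (hA.finite_support p) (fun ω => hsupp ω p i l)
      fun z hz => ?_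
    have hc := (hA.continuous_gradLoss hz).measurable
    exact (hc.comp hx).sub (hc.comp hy)
  unfold gradDiff
  fun_prop

variable {A : Params} {xt0 : E d}

/-- Before the minibatches of iteration `i` are drawn, the state of the algorithm is known. -/
lemma Problem.Assumptions.measurable_run (hA : pb.Assumptions L G ζ xstar)
    (hsupp : ∀ ω p i l, (τ ω).z p i l ∈ (pb.D p).support) (i : ℕ) :
    (Measurable[history τ i] fun ω => (run pb A xt0 (τ ω) i).x) ∧
    (Measurable[history τ i] fun ω => (run pb A xt0 (τ ω) i).xprev) ∧
    (Measurable[history τ i] fun ω => (run pb A xt0 (τ ω) i).v) ∧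
    (Measurable[history τ i] fun ω => (run pb A xt0 (τ ω) i).xround) ∧
    (∀ p, Measurable[history τ i] fun ω => (run pb A xt0 (τ ω) i).vround p) := by
  induction i with
  | zero =>
    refine ⟨?_, measurable_const, measurable_const, measurable_const, fun _ => measurable_const⟩
    have := measurable_ξ_history τ 0 0
    simp only [run]
    fun_prop
  | succ i ih =>
    have hle := history_mono τ (Nat.le_succ i)
    obtain ⟨h1, h2, h3, h4, h5⟩ := ih
    replace h1 := h1.mono hle le_rfl
    replace h2 := h2.mono hle le_rfl
    replace h3 := h3.mono hle le_rfl
    replace h4 := h4.mono hle le_rfl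
    replace h5 := fun p => (h5 p).mono hle le_rfl
    have hr : ∀ p, Measurable[history τ (i + 1)]
        fun ω => roundEstimator pb A (τ ω) i (run pb A xt0 (τ ω) i) p := by
      intro p
      unfold roundEstimator
      split_ifs
      · exact (hA.twice_differentiable p).continuous.measurable.comp h1
      · exact (hA.measurable_gradDiff hsupp _ p (Nat.lt_succ_self i) h1 h4).add (h5 p)
    have he : Measurable[history τ (i + 1)]
        fun ω => estimator pb A (τ ω) i (run pb A xt0 (τ ω) i) := by
      unfold estimator
      split_ifs
      · have := Finset.measurable_fun_sum Finset.univ fun p _ => hr p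
        fun_prop
      · exact (measurable_apply_fin (measurable_worker_history τ (i + 1) (i / A.K))
          fun p => hA.measurable_gradDiff hsupp _ p (Nat.lt_succ_self i) h1 h2).add h3
    have hξ := measurable_ξ_history τ (i + 1) (i + 1)
    refine ⟨?_, h1, he, ?_, fun p => ?_⟩
    · simp only [run, step]
      fun_prop
    · simp only [run, step]
      split_ifs
      · exact h1
      · exact h4
    · simp only [run, step]
      split_ifs
      · exact hr p
      · exact h5 p

lemma Problem.Assumptions.measurable_iterate (hA : pb.Assumptions L G ζ xstar)
    (hsupp : ∀ ω p i l, (τ ω).z p i l ∈ (pb.D p).support) {i j : ℕ} (hij : i ≤ j) :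
    Measurable[history τ j] fun ω => iterate pb A xt0 (τ ω) i :=
  (hA.measurable_run hsupp i).1.mono (history_mono τ hij) le_rfl

end RunMeasurable

/-! ### Sampling errors as sums of centred blocks -/

section Noise

variable {d P : ℕ} {Z Ω : Type*} [MeasurableSpace Z] [MeasurableSingletonClass Z]
  {pb : Problem d P Z} {L G ζ : ℝ} {xstar : E d} {τ : Ω → Tape d P Z} {A : Params} {xt0 : E d}

/-- The bound `min (L ‖x_i - x_{i'}‖) (2 G)` for differences of stochastic gradients. -/
def diffBound (pb : Problem d P Z) (A : Params) (xt0 : E d) (L G : ℝ) (τ : Tape d P Z)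
    (i i' : ℕ) : ℝ :=
  min (L * ‖iterate pb A xt0 τ i - iterate pb A xt0 τ i'‖) (2 * G)

omit [MeasurableSpace Z] [MeasurableSingletonClass Z] in
lemma measurable_const_mul_min_norm_sub {F : MeasurableSpace Ω} {x y : Ω → E d}
    (hx : Measurable x) (hy : Measurable y) (c a b : ℝ) :
    Measurable fun ω => c * min (a * ‖x ω - y ω‖) b := by
  fun_prop

/-- The block data of scaled differences of stochastic gradients between two iterates. -/
lemma Problem.Assumptions.blockData (hA : pb.Assumptions L G ζ xstar)
    (hsupp : ∀ ω p i l, (τ ω).z p i l ∈ (pb.D p).support) {n n' : ℕ → ℕ} (hn : StrictMono n)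
    (hn' : ∀ k, n' k ≤ n k) {c : ℕ → ℝ} (hc : ∀ k, 0 ≤ c k) :
    BlockData pb hA.finite_support τ n
      (fun k _ ω z => c k • (pb.gradLoss (iterate pb A xt0 (τ ω) (n k)) z -
        pb.gradLoss (iterate pb A xt0 (τ ω) (n' k)) z))
      (fun k ω => 2 * c k * diffBound pb A xt0 L G (τ ω) (n k) (n' k)) where
  strictMono := hn
  measurable_φ k p z hz := by
    have h := (hA.continuous_gradLoss hz).measurable
    have h1 := h.comp (hA.measurable_iterate (A := A) (xt0 := xt0) hsupp (le_refl (n k)))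
    have h2 := h.comp (hA.measurable_iterate (A := A) (xt0 := xt0) hsupp (hn' k))
    exact (h1.sub h2).const_smul (c k)
  measurable_σ k := by
    have h1 := hA.measurable_iterate (A := A) (xt0 := xt0) hsupp (le_refl (n k))
    have h2 := hA.measurable_iterate (A := A) (xt0 := xt0) hsupp (hn' k)
    unfold diffBound
    exact measurable_const_mul_min_norm_sub h1 h2 _ _ _
  norm_le k p ω z hz := by
    have hb : ∀ z ∈ (pb.D p).support, ‖c k • (pb.gradLoss (iterate pb A xt0 (τ ω) (n k)) z -
        pb.gradLoss (iterate pb A xt0 (τ ω) (n' k)) z)‖ ≤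
        c k * diffBound pb A xt0 L G (τ ω) (n k) (n' k) := by
      intro z hz
      rw [norm_smul, Real.norm_of_nonneg (hc k)]
      exact mul_le_mul_of_nonneg_left (hA.norm_gradLoss_sub_le p hz _ _) (hc k)
    -- Centring at most doubles the bound, hence the factor 2 in σ.
    refine (norm_sub_le _ _).trans ?_
    linarith [hb z hz, norm_supportMean_le (pb.D p) (hA.finite_support p) hb]

omit [MeasurableSingletonClass Z] in
lemma diffBound_sq_le (hL : 0 ≤ L) (hG : 0 ≤ G) (τ : Tape d P Z) (i i' : ℕ) :
    diffBound pb A xt0 L G τ i i' ^ 2 ≤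
        L ^ 2 * ‖iterate pb A xt0 τ i - iterate pb A xt0 τ i'‖ ^ 2 ∧
      diffBound pb A xt0 L G τ i i' ^ 2 ≤ 4 * G ^ 2 := by
  have h0 : 0 ≤ diffBound pb A xt0 L G τ i i' :=
    le_min (mul_nonneg hL (norm_nonneg _)) (by linarith)
  constructor
  · rw [← mul_pow]
    exact pow_le_pow_left₀ h0 (min_le_left _ _) 2
  · rw [show 4 * G ^ 2 = (2 * G) ^ 2 by ring]
    exact pow_le_pow_left₀ h0 (min_le_right _ _) 2

lemma Problem.Assumptions.sum_centred_gradLoss (hA : pb.Assumptions L G ζ xstar) (p : Fin P)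
    (c : ℝ) {m : ℕ} (hm : 0 < m) (z : ℕ → Z) (x y : E d) :
    ∑ l ∈ Finset.range m, (c • (pb.gradLoss x (z l) - pb.gradLoss y (z l)) -
      supportMean (pb.D p) (hA.finite_support p)
        (fun z => c • (pb.gradLoss x z - pb.gradLoss y z))) =
    (c * m) • (gradDiff pb m z x y -
      (gradient (pb.localObj p) x - gradient (pb.localObj p) y)) := by
  have hm' : (m : ℝ) ≠ 0 := by exact_mod_cast hm.ne'
  simp only [supportMean_smul, supportMean_sub, ← hA.gradient_localObj, ← smul_sub]
  rw [← Finset.smul_sum, Finset.sum_sub_distrib, Finset.sum_const, Finset.card_range, mul_smul,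
    gradDiff, smul_sub (m : ℝ), smul_smul (m : ℝ), mul_one_div_cancel hm', one_smul,
    Nat.cast_smul_eq_nsmul ℝ]

/-- The accumulated sampling error of the local steps of worker `p` in round `j`. -/
def localNoise (hA : pb.Assumptions L G ζ xstar) (A : Params) (xt0 : E d) (τ : Ω → Tape d P Z)
    (j : ℕ) (p : Fin P) : ℕ → Ω → E d :=
  noiseSum pb hA.finite_support τ (fun k => A.K * j + (k + 1))
    (fun k => {p} ×ˢ Finset.range (A.batch (k + 1)))
    (fun k _ ω z => (1 / (A.batch (k + 1) : ℝ)) •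
      (pb.gradLoss (iterate pb A xt0 (τ ω) (A.K * j + (k + 1))) z -
        pb.gradLoss (iterate pb A xt0 (τ ω) (A.K * j + k)) z))

/-- The variance proxy of `localNoise`. -/
def localVar (pb : Problem d P Z) (L G : ℝ) (A : Params) (xt0 : E d) (τ : Ω → Tape d P Z)
    (j : ℕ) (p : Fin P) : ℕ → Ω → ℝ :=
  varSum (fun k => {p} ×ˢ Finset.range (A.batch (k + 1)))
    (fun k ω => 2 * (1 / (A.batch (k + 1) : ℝ)) *
      diffBound pb A xt0 L G (τ ω) (A.K * j + (k + 1)) (A.K * j + k))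

/-- The accumulated sampling error of the rounds of stage `s`. -/
def stageNoise (hA : pb.Assumptions L G ζ xstar) (A : Params) (xt0 : E d) (τ : Ω → Tape d P Z)
    (s : ℕ) : ℕ → Ω → E d :=
  noiseSum pb hA.finite_support τ (fun t => A.K * (A.T * s + t + 1))
    (fun _ => Finset.univ ×ˢ Finset.range (A.K * A.b))
    (fun t _ ω z => (1 / (P * (A.K * A.b : ℕ) : ℝ)) •
      (pb.gradLoss (iterate pb A xt0 (τ ω) (A.K * (A.T * s + t + 1))) z -
        pb.gradLoss (iterate pb A xt0 (τ ω) (A.K * (A.T * s + t))) z))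

/-- The variance proxy of `stageNoise`. -/
def stageVar (pb : Problem d P Z) (L G : ℝ) (A : Params) (xt0 : E d) (τ : Ω → Tape d P Z)
    (s : ℕ) : ℕ → Ω → ℝ :=
  varSum (fun _ => (Finset.univ : Finset (Fin P)) ×ˢ Finset.range (A.K * A.b))
    (fun t ω => 2 * (1 / (P * (A.K * A.b : ℕ) : ℝ)) *
      diffBound pb A xt0 L G (τ ω) (A.K * (A.T * s + t + 1)) (A.K * (A.T * s + t)))

-- Apart from this lower bound, the batch sizes play no role in the estimates: the larger batches at
-- multiples of ⌈√K⌉ are not exploited.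
omit [MeasurableSingletonClass Z] in
lemma Params.le_batch (A : Params) (hK : 0 < A.K) (k : ℕ) : A.b ≤ A.batch k := by
  have h : 1 ≤ ⌈Real.sqrt A.K⌉₊ := Nat.one_le_iff_ne_zero.2 (Nat.ceil_pos.2 (by positivity)).ne'
  unfold Params.batch
  split_ifs
  · exact Nat.le_mul_of_pos_left _ h
  · exact le_rfl

/-- The recursion telescopes. The mean of a minibatch difference is the increment of ∇f_p for the
selected worker p, not of ∇f; the discrepancy is the drift that heterogeneity controls. -/
lemma localNoise_eq (hA : pb.Assumptions L G ζ xstar) (hb : 0 < A.b) (j : ℕ) (ω : Ω) :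
    ∀ k < A.K, gradEst pb A xt0 (τ ω) (A.K * j + k) - gradEst pb A xt0 (τ ω) (A.K * j) -
      (gradient (pb.localObj ((τ ω).worker j)) (iterate pb A xt0 (τ ω) (A.K * j + k)) -
        gradient (pb.localObj ((τ ω).worker j)) (iterate pb A xt0 (τ ω) (A.K * j))) =
      localNoise hA A xt0 τ j ((τ ω).worker j) k ω := by
  intro k
  induction k with
  | zero => intro _; simp [localNoise, noiseSum]
  | succ k ih =>
    intro hk
    have hm : 0 < A.batch (k + 1) := hb.trans_le (A.le_batch (by omega) _)
    have hm' : (A.batch (k + 1) : ℝ) ≠ 0 := by exact_mod_cast hm.ne'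
    replace ih := ih (by omega)
    rw [localNoise, noiseSum] at ih ⊢
    rw [Finset.sum_range_succ, ← ih,
      gradEst_succ j hk, blockNoise, Finset.sum_product, Finset.sum_singleton,
      hA.sum_centred_gradLoss _ _ hm, one_div, inv_mul_cancel₀ hm', one_smul]
    abel

/-- The recursion over rounds starts from the exact gradient at t = 0. All workers take part, so the
increments have the mean of ∇f and there is no drift. -/
lemma stageNoise_eq [NeZero P] (hA : pb.Assumptions L G ζ xstar) (hK : 0 < A.K) (hb : 0 < A.b)
    (s : ℕ) (ω : Ω) :
    ∀ t < A.T, gradEst pb A xt0 (τ ω) (A.K * (A.T * s + t)) -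
      gradient pb.obj (iterate pb A xt0 (τ ω) (A.K * (A.T * s + t))) =
      stageNoise hA A xt0 τ s t ω := by
  intro t
  induction t with
  | zero =>
    intro _
    rw [gradEst_round, hA.gradient_obj]
    simp [stageNoise, noiseSum, roundEst_of_mod_eq_zero hK]
  | succ t ih =>
    intro ht
    have hmod : (A.T * s + t + 1) % A.T ≠ 0 := by
      rw [add_assoc, Nat.mul_add_mod, Nat.mod_eq_of_lt ht]; omega
    have hm : 0 < A.K * A.b := Nat.mul_pos hK hb
    have hm' : ((A.K * A.b : ℕ) : ℝ) ≠ 0 := by exact_mod_cast hm.ne'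
    replace ih := ih (by omega)
    rw [stageNoise, noiseSum] at ih ⊢
    rw [Finset.sum_range_succ, ← ih,
      blockNoise, Finset.sum_product, gradEst_round, gradEst_round, ← add_assoc,
      hA.gradient_obj, hA.gradient_obj]
    simp only [hA.sum_centred_gradLoss _ _ hm, roundEst_succ hK hmod]
    rw [← Finset.smul_sum, show 1 / ((P : ℝ) * (A.K * A.b : ℕ)) * (A.K * A.b : ℕ) = 1 / P by
      field_simp]
    simp only [Finset.sum_add_distrib, Finset.sum_sub_distrib, smul_add, smul_sub]
    abel

-- A block of m samples with weight 1/m contributes m (2/m)² = 4/m times the squared bound of a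
-- difference. The first estimate enters the error bound; the second holds for every outcome and
-- only counts levels.
omit [MeasurableSingletonClass Z] in
lemma localVar_le (hL : 0 ≤ L) (hG : 0 ≤ G) (hK : 0 < A.K) (hb : 0 < A.b) (j : ℕ) (p : Fin P)
    (k : ℕ) (ω : Ω) :
    localVar pb L G A xt0 τ j p k ω ≤ 4 * L ^ 2 / A.b * ∑ m ∈ Finset.range k,
        ‖iterate pb A xt0 (τ ω) (A.K * j + (m + 1)) - iterate pb A xt0 (τ ω) (A.K * j + m)‖ ^ 2 ∧
      localVar pb L G A xt0 τ j p k ω ≤ 16 * G ^ 2 * k := by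
  have hb1 : (1 : ℝ) ≤ A.b := by exact_mod_cast hb
  have key : ∀ m, ((({p} : Finset (Fin P)) ×ˢ Finset.range (A.batch (m + 1))).card : ℝ) *
      (2 * (1 / (A.batch (m + 1) : ℝ)) *
        diffBound pb A xt0 L G (τ ω) (A.K * j + (m + 1)) (A.K * j + m)) ^ 2 ≤
      4 / A.b * diffBound pb A xt0 L G (τ ω) (A.K * j + (m + 1)) (A.K * j + m) ^ 2 := by
    intro m
    have h1 : (A.b : ℝ) ≤ A.batch (m + 1) := by exact_mod_cast A.le_batch hK _
    have h2 : (0 : ℝ) < A.batch (m + 1) := by linarith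
    rw [Finset.card_product, Finset.card_singleton, one_mul, Finset.card_range]
    calc _ = 4 / A.batch (m + 1) *
          diffBound pb A xt0 L G (τ ω) (A.K * j + (m + 1)) (A.K * j + m) ^ 2 := by
          field_simp; ring
      _ ≤ _ := by gcongr
  unfold localVar varSum
  constructor
  · rw [Finset.mul_sum]
    refine Finset.sum_le_sum fun m _ => (key m).trans ?_
    calc _ ≤ 4 / A.b * (L ^ 2 * _) := by
          gcongr; exact (diffBound_sq_le hL hG _ _ _).1
      _ = _ := by ring
  · calc _ ≤ ∑ m ∈ Finset.range k, 16 * G ^ 2 := by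
          refine Finset.sum_le_sum fun m _ => (key m).trans ?_
          calc _ ≤ 4 / 1 * (4 * G ^ 2) := by
                gcongr; exact (diffBound_sq_le hL hG _ _ _).2
            _ = _ := by ring
      _ = _ := by simp; ring

omit [MeasurableSingletonClass Z] in
lemma stageVar_le [NeZero P] (hL : 0 ≤ L) (hG : 0 ≤ G) (hK : 0 < A.K) (hb : 0 < A.b) (s : ℕ)
    (t : ℕ) (ω : Ω) :
    stageVar pb L G A xt0 τ s t ω ≤ 4 * L ^ 2 / (P * (A.K * A.b)) * ∑ m ∈ Finset.range t,
        ‖iterate pb A xt0 (τ ω) (A.K * (A.T * s + m + 1)) -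
          iterate pb A xt0 (τ ω) (A.K * (A.T * s + m))‖ ^ 2 ∧
      stageVar pb L G A xt0 τ s t ω ≤ 16 * G ^ 2 * t := by
  have hP : (1 : ℝ) ≤ P := by exact_mod_cast Nat.one_le_iff_ne_zero.2 (NeZero.ne P)
  have hK1 : (1 : ℝ) ≤ A.K := by exact_mod_cast hK
  have hb1 : (1 : ℝ) ≤ A.b := by exact_mod_cast hb
  have hPKb : (1 : ℝ) ≤ P * (A.K * A.b) := by
    have := mul_le_mul hK1 hb1 zero_le_one (by linarith)
    nlinarith
  have key : ∀ m, (((Finset.univ : Finset (Fin P)) ×ˢ Finset.range (A.K * A.b)).card : ℝ) *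
      (2 * (1 / (P * (A.K * A.b : ℕ) : ℝ)) * diffBound pb A xt0 L G (τ ω)
        (A.K * (A.T * s + m + 1)) (A.K * (A.T * s + m))) ^ 2 =
      4 / (P * (A.K * A.b)) * diffBound pb A xt0 L G (τ ω)
        (A.K * (A.T * s + m + 1)) (A.K * (A.T * s + m)) ^ 2 := by
    intro m
    rw [Finset.card_product, Finset.card_univ, Fintype.card_fin, Finset.card_range]
    push_cast
    field_simp; ring
  unfold stageVar varSum
  constructor
  · rw [Finset.mul_sum]
    refine Finset.sum_le_sum fun m _ => (key m).le.trans ?_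
    calc _ ≤ 4 / (P * (A.K * A.b)) * (L ^ 2 * _) := by
          gcongr; exact (diffBound_sq_le hL hG _ _ _).1
      _ = _ := by ring
  · calc _ ≤ ∑ m ∈ Finset.range t, 16 * G ^ 2 := by
          refine Finset.sum_le_sum fun m _ => (key m).le.trans ?_
          calc _ ≤ 4 / 1 * (4 * G ^ 2) := by
                gcongr; exact (diffBound_sq_le hL hG _ _ _).2
            _ = _ := by ring
      _ = _ := by simp; ring

end Noise

/-! ### The union bound over iterations and rounds -/

section GoodEvent

variable {d P : ℕ} {Z Ω : Type*} [MeasurableSpace Z] [MeasurableSingletonClass Z]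
  {pb : Problem d P Z} {L G ζ : ℝ} {xstar : E d}

/-- The sampling errors are, up to the floor `ρ`, of the order of their variance proxies. -/
def NoiseBounded (hA : pb.Assumptions L G ζ xstar) (A : Params) (xt0 : E d) (τ : Ω → Tape d P Z)
    (S : ℕ) (θ ρ : ℝ) (ω : Ω) : Prop :=
  (∀ j < A.T * S, ∀ k < A.K, ‖localNoise hA A xt0 τ j ((τ ω).worker j) k ω‖ ^ 2 ≤
      2 * θ * (localVar pb L G A xt0 τ j ((τ ω).worker j) k ω + ρ)) ∧
    ∀ s < S, ∀ t < A.T, ‖stageNoise hA A xt0 τ s t ω‖ ^ 2 ≤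
      2 * θ * (stageVar pb L G A xt0 τ s t ω + ρ)

variable [NeZero P] [mΩ : MeasurableSpace Ω] {r : ℝ} {μ : Measure Ω} [IsProbabilityMeasure μ]
  {τ : Ω → Tape d P Z} {A : Params} {xt0 : E d}

/-- The selected worker is random, while the martingale bound concerns a fixed p. Failure is split
by the value of the worker, which belongs to the past; as the masses of {worker = p} add up to 1, no
factor P is lost. -/
lemma IsSampling.measure_not_noiseBounded_le (hS : IsSampling pb r μ τ)
    (hA : pb.Assumptions L G ζ xstar) (hL : 0 ≤ L)
    (hsupp : ∀ ω p i l, (τ ω).z p i l ∈ (pb.D p).support)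
    (hK : 0 < A.K) (hb : 0 < A.b) (S : ℕ) {θ ρ : ℝ} (hθ : 0 ≤ θ) (hρ : 0 < ρ) {m : ℕ}
    (hmK : 16 * G ^ 2 * A.K ≤ m * ρ) (hmT : 16 * G ^ 2 * A.T ≤ m * ρ) :
    μ {ω | ¬ NoiseBounded hA A xt0 τ S θ ρ ω} ≤
      ENNReal.ofReal ((A.T * S * A.K + S * A.T) * ((m + 1) * (2 * Real.exp (-θ)))) := by
  have hG := hA.G_nonneg
  set δ : ENNReal := ENNReal.ofReal ((m + 1) * (2 * Real.exp (-θ))) with hδ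
  set U : ℕ → ℕ → Fin P → Set Ω := fun j k p => ((fun ω => (τ ω).worker j) ⁻¹' {p}) ∩
    {ω | 2 * θ * (localVar pb L G A xt0 τ j p k ω + ρ) < ‖localNoise hA A xt0 τ j p k ω‖ ^ 2}
    with hU
  set Y : ℕ → ℕ → Set Ω := fun s t => Set.univ ∩
    {ω | 2 * θ * (stageVar pb L G A xt0 τ s t ω + ρ) < ‖stageNoise hA A xt0 τ s t ω‖ ^ 2}
    with hY
  have hUle : ∀ j, ∀ k < A.K, ∀ p, μ (U j k p) ≤ δ * μ ((fun ω => (τ ω).worker j) ⁻¹' {p}) := by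
    intro j k hk p
    refine hS.measure_noiseSum_sq_gt_le
      (hA.blockData hsupp (fun a b h => by simpa using h) (fun k => by omega)
        fun k => by positivity) hsupp _
      (measurable_worker_history τ _ j (measurableSet_singleton p)) k hρ hθ fun ω => ?_
    refine (localVar_le hL hG hK hb j p k ω).2.trans (le_trans ?_ hmK)
    gcongr
  have hYle : ∀ s, ∀ t < A.T, μ (Y s t) ≤ δ := by
    intro s t ht
    refine (hS.measure_noiseSum_sq_gt_le
      (hA.blockData hsupp (fun a b h => Nat.mul_lt_mul_of_pos_left (by omega) hK)
        (fun k => Nat.mul_le_mul_left _ (Nat.le_succ _))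
        fun k => by positivity) hsupp _ MeasurableSet.univ t hρ hθ fun ω => ?_).trans
          (by rw [measure_univ, mul_one])
    refine (stageVar_le hL hG hK hb s t ω).2.trans (le_trans ?_ hmT)
    gcongr
  have hsub : {ω | ¬ NoiseBounded hA A xt0 τ S θ ρ ω} ⊆
      (⋃ j ∈ Finset.range (A.T * S), ⋃ k ∈ Finset.range A.K, ⋃ p ∈ Finset.univ, U j k p) ∪
        ⋃ s ∈ Finset.range S, ⋃ t ∈ Finset.range A.T, Y s t := by
    intro ω hω
    simp only [Set.mem_ofPred_eq, NoiseBounded, not_and_or, not_forall, not_le] at hω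
    rcases hω with ⟨j, hj, k, hk, h⟩ | ⟨s, hs, t, ht, h⟩
    · left
      simp only [Set.mem_iUnion, Finset.mem_range, exists_prop]
      exact ⟨j, hj, k, hk, _, Finset.mem_univ _, rfl, h⟩
    · right
      simp only [Set.mem_iUnion, Finset.mem_range, exists_prop]
      exact ⟨s, hs, t, ht, trivial, h⟩
  have hUsum : μ (⋃ j ∈ Finset.range (A.T * S), ⋃ k ∈ Finset.range A.K,
      ⋃ p ∈ Finset.univ, U j k p) ≤ (A.T * S * A.K : ℕ) * δ := by
    calc _ ≤ ∑ j ∈ Finset.range (A.T * S), ∑ k ∈ Finset.range A.K, δ := by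
          refine (measure_biUnion_finset_le _ _).trans (Finset.sum_le_sum fun j _ => ?_)
          refine (measure_biUnion_finset_le _ _).trans (Finset.sum_le_sum fun k hk => ?_)
          refine (measure_biUnion_finset_le _ _).trans ?_
          refine (Finset.sum_le_sum fun p _ => hUle j k (Finset.mem_range.1 hk) p).trans ?_
          rw [← Finset.mul_sum, sum_measure_preimage_singleton _ fun p _ =>
            hS.measurable_worker j (measurableSet_singleton p)]
          simp
      _ = _ := by simp [mul_assoc]
  have hYsum : μ (⋃ s ∈ Finset.range S, ⋃ t ∈ Finset.range A.T, Y s t) ≤ (S * A.T : ℕ) * δ := by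
    calc _ ≤ ∑ s ∈ Finset.range S, ∑ t ∈ Finset.range A.T, δ := by
          refine (measure_biUnion_finset_le _ _).trans (Finset.sum_le_sum fun s _ => ?_)
          refine (measure_biUnion_finset_le _ _).trans (Finset.sum_le_sum fun t ht => ?_)
          exact hYle s t (Finset.mem_range.1 ht)
      _ = _ := by simp [mul_assoc]
  calc _ ≤ (A.T * S * A.K : ℕ) * δ + (S * A.T : ℕ) * δ :=
        (measure_mono hsub).trans ((measure_union_le _ _).trans (add_le_add hUsum hYsum))
    _ = _ := by
        rw [← add_mul, ENNReal.ofReal_mul (by positivity), ← hδ,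
          ← ENNReal.ofReal_natCast, ← ENNReal.ofReal_natCast, ← ENNReal.ofReal_add
          (by positivity) (by positivity)]
        push_cast; rfl

end GoodEvent

/-! ### The accumulated error on the good event -/

section Deterministic

lemma sum_range_mul_eq {M : Type*} [AddCommMonoid M] (f : ℕ → M) (K n : ℕ) :
    ∑ i ∈ Finset.range (K * n), f i =
      ∑ j ∈ Finset.range n, ∑ k ∈ Finset.range K, f (K * j + k) := by
  induction n with
  | zero => simp
  | succ n ih => rw [Nat.mul_succ, Finset.sum_range_add, ih, Finset.sum_range_succ]

variable {V : Type*} [SeminormedAddCommGroup V]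

lemma norm_add_three_sq_le (a b c : V) :
    ‖a + b + c‖ ^ 2 ≤ 3 * (‖a‖ ^ 2 + ‖b‖ ^ 2 + ‖c‖ ^ 2) := by
  have h := norm_add₃_le (a := a) (b := b) (c := c)
  have h0 := norm_nonneg (a + b + c)
  nlinarith [sq_nonneg (‖a‖ - ‖b‖), sq_nonneg (‖a‖ - ‖c‖), sq_nonneg (‖b‖ - ‖c‖)]

variable [NormedSpace ℝ V]

/-- The squared displacement after `k` steps `x_{i+1} = x_i - η u_i`. -/
lemma norm_displacement_sq_le {x u : ℕ → V} {η : ℝ} (hx : ∀ i, x (i + 1) = x i - η • u i)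
    (i k : ℕ) : ‖x (i + k) - x i‖ ^ 2 ≤ k * (η ^ 2 * ∑ m ∈ Finset.range k, ‖u (i + m)‖ ^ 2) := by
  have h1 : ‖x (i + k) - x i‖ ≤ ∑ m ∈ Finset.range k, |η| * ‖u (i + m)‖ := by
    have : x (i + k) - x i = ∑ m ∈ Finset.range k, (x (i + (m + 1)) - x (i + m)) := by
      rw [Finset.sum_range_sub fun m => x (i + m)]; rfl
    rw [this]
    refine norm_sum_le_of_le _ fun m _ => ?_
    rw [← add_assoc, hx, sub_sub_cancel_left, norm_neg, norm_smul, Real.norm_eq_abs]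
  calc ‖x (i + k) - x i‖ ^ 2 ≤ (∑ m ∈ Finset.range k, |η| * ‖u (i + m)‖) ^ 2 := by gcongr
    _ ≤ (Finset.range k).card * ∑ m ∈ Finset.range k, (|η| * ‖u (i + m)‖) ^ 2 :=
        sq_sum_le_card_mul_sum_sq
    _ = _ := by simp only [Finset.card_range, mul_pow, sq_abs, Finset.mul_sum]

variable {d P : ℕ} {Z Ω : Type*} [MeasurableSpace Z] [MeasurableSingletonClass Z]
  {pb : Problem d P Z} {L G ζ : ℝ} {xstar : E d} [NeZero P]
  {τ : Ω → Tape d P Z} {A : Params} {xt0 : E d}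

/-- The accumulated squared error of the estimators in terms of the accumulated squared steps. -/
lemma NoiseBounded.sum_error_sq_le {hA : pb.Assumptions L G ζ xstar} {S : ℕ} {θ ρ : ℝ} {ω : Ω}
    (h : NoiseBounded hA A xt0 τ S θ ρ ω) (hL : 0 ≤ L) (hK : 0 < A.K) (hb : 0 < A.b)
    (hθ : 0 ≤ θ) {u : ℕ → E d}
    (hu : ∀ i, iterate pb A xt0 (τ ω) (i + 1) = iterate pb A xt0 (τ ω) i - A.η • u i) :
    ∑ i ∈ Finset.range (A.K * (A.T * S)),
      ‖gradEst pb A xt0 (τ ω) i - gradient pb.obj (iterate pb A xt0 (τ ω) i)‖ ^ 2 ≤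
    3 * (8 * θ * L ^ 2 * A.η ^ 2 * A.K / A.b + (A.K * ζ) ^ 2 * A.η ^ 2 +
        8 * θ * L ^ 2 * A.η ^ 2 * (A.K * A.T / (P * A.b))) *
      (∑ i ∈ Finset.range (A.K * (A.T * S)), ‖u i‖ ^ 2) +
    12 * θ * ρ * (A.K * (A.T * S)) := by
  have hG := hA.G_nonneg
  set x := iterate pb A xt0 (τ ω) with hx
  -- R and Q collect the squared steps of a round and of a stage.
  set R : ℕ → ℝ := fun j => ∑ m ∈ Finset.range A.K, ‖u (A.K * j + m)‖ ^ 2 with hR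
  set Q : ℕ → ℝ := fun s => ∑ t ∈ Finset.range A.T, R (A.T * s + t) with hQ
  have hP0 : (0 : ℝ) < P := by exact_mod_cast Nat.pos_of_ne_zero (NeZero.ne P)
  have hK0 : (0 : ℝ) < A.K := by exact_mod_cast hK
  have hb0 : (0 : ℝ) < A.b := by exact_mod_cast hb
  have hR0 : ∀ j, 0 ≤ R j := fun j => Finset.sum_nonneg fun _ _ => by positivity
  have hpart : ∀ j, ∀ k ≤ A.K, ∑ m ∈ Finset.range k, ‖u (A.K * j + m)‖ ^ 2 ≤ R j := fun j k hk =>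
    Finset.sum_le_sum_of_subset_of_nonneg (Finset.range_mono hk) fun _ _ _ => by positivity
  have hstep : ∀ i, ‖x (i + 1) - x i‖ ^ 2 = A.η ^ 2 * ‖u i‖ ^ 2 := by
    intro i
    rw [hu, sub_sub_cancel_left, norm_neg, norm_smul, mul_pow, Real.norm_eq_abs, sq_abs]
  have hloc : ∀ j < A.T * S, ∀ k < A.K,
      ‖localNoise hA A xt0 τ j ((τ ω).worker j) k ω‖ ^ 2 ≤
        2 * θ * (4 * L ^ 2 / A.b * (A.η ^ 2 * R j) + ρ) := by
    intro j hj k hk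
    refine (h.1 j hj k hk).trans ?_
    gcongr
    refine (localVar_le hL hG hK hb j _ k ω).1.trans ?_
    gcongr
    rw [← hx]
    calc _ = ∑ m ∈ Finset.range k, A.η ^ 2 * ‖u (A.K * j + m)‖ ^ 2 :=
          Finset.sum_congr rfl fun m _ => hstep _
      _ ≤ _ := by rw [← Finset.mul_sum]; gcongr; exact hpart j k hk.le
  have hdisp : ∀ j, ∀ k ≤ A.K, ‖x (A.K * j + k) - x (A.K * j)‖ ^ 2 ≤ A.K * (A.η ^ 2 * R j) := by
    intro j k hk
    refine (norm_displacement_sq_le hu (A.K * j) k).trans ?_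
    gcongr
    exact hpart j k hk
  have hbias : ∀ j, ∀ k < A.K, ∀ p, ‖(gradient (pb.localObj p) (x (A.K * j + k)) -
      gradient pb.obj (x (A.K * j + k))) - (gradient (pb.localObj p) (x (A.K * j)) -
      gradient pb.obj (x (A.K * j)))‖ ^ 2 ≤ ζ ^ 2 * (A.K * (A.η ^ 2 * R j)) := by
    intro j k hk p
    calc _ ≤ (ζ * ‖x (A.K * j + k) - x (A.K * j)‖) ^ 2 := by
          gcongr; exact hA.norm_bias_le p _ _
      _ = ζ ^ 2 * ‖x (A.K * j + k) - x (A.K * j)‖ ^ 2 := by ring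
      _ ≤ _ := by gcongr; exact hdisp j k hk.le
  have hstage : ∀ s < S, ∀ t < A.T, ‖stageNoise hA A xt0 τ s t ω‖ ^ 2 ≤
      2 * θ * (4 * L ^ 2 / (P * A.b) * (A.η ^ 2 * Q s) + ρ) := by
    intro s hs t ht
    refine (h.2 s hs t ht).trans ?_
    gcongr
    refine (stageVar_le hL hG hK hb s t ω).1.trans ?_
    rw [← hx]
    -- By Cauchy–Schwarz a round moves the iterate by at most K η² R in square; this K cancels the
    -- one in the sample count P K b.
    calc _ ≤ 4 * L ^ 2 / (P * (A.K * A.b)) * ∑ m ∈ Finset.range t,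
          A.K * (A.η ^ 2 * R (A.T * s + m)) := by
          gcongr with m
          rw [mul_add_one]
          exact hdisp _ _ le_rfl
      _ ≤ 4 * L ^ 2 / (P * (A.K * A.b)) * ∑ m ∈ Finset.range A.T,
          A.K * (A.η ^ 2 * R (A.T * s + m)) := by
          gcongr
      _ = _ := by
          rw [← Finset.mul_sum, ← Finset.mul_sum]
          field_simp
          rfl
  have herr : ∀ s < S, ∀ t < A.T, ∀ k < A.K,
      ‖gradEst pb A xt0 (τ ω) (A.K * (A.T * s + t) + k) -
        gradient pb.obj (x (A.K * (A.T * s + t) + k))‖ ^ 2 ≤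
      3 * (2 * θ * (4 * L ^ 2 / A.b * (A.η ^ 2 * R (A.T * s + t)) + ρ) +
        ζ ^ 2 * (A.K * (A.η ^ 2 * R (A.T * s + t))) +
        2 * θ * (4 * L ^ 2 / (P * A.b) * (A.η ^ 2 * Q s) + ρ)) := by
    intro s hs t ht k hk
    set j := A.T * s + t with hj
    have hjlt : j < A.T * S := by
      calc j < A.T * (s + 1) := by rw [hj, mul_add_one]; omega
        _ ≤ A.T * S := Nat.mul_le_mul_left _ hs
    -- Local sampling error, drift of ∇f_p - ∇f since the start of the round, and sampling error of
    -- the stage.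
    have hdec : gradEst pb A xt0 (τ ω) (A.K * j + k) - gradient pb.obj (x (A.K * j + k)) =
        localNoise hA A xt0 τ j ((τ ω).worker j) k ω +
        ((gradient (pb.localObj ((τ ω).worker j)) (x (A.K * j + k)) -
          gradient pb.obj (x (A.K * j + k))) -
          (gradient (pb.localObj ((τ ω).worker j)) (x (A.K * j)) -
          gradient pb.obj (x (A.K * j)))) + stageNoise hA A xt0 τ s t ω := by
      rw [← localNoise_eq hA hb j ω k hk, ← stageNoise_eq hA hK hb s ω t ht]
      abel
    rw [hdec]
    refine (norm_add_three_sq_le _ _ _).trans ?_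
    gcongr
    · exact hloc j hjlt k hk
    · exact hbias j k hk _
    · exact hstage s hs t ht
  have hsplit : ∀ f : ℕ → ℝ, ∑ i ∈ Finset.range (A.K * (A.T * S)), f i =
      ∑ s ∈ Finset.range S, ∑ t ∈ Finset.range A.T, ∑ k ∈ Finset.range A.K,
        f (A.K * (A.T * s + t) + k) := by
    intro f
    rw [sum_range_mul_eq, sum_range_mul_eq]
  have hUQ : ∑ i ∈ Finset.range (A.K * (A.T * S)), ‖u i‖ ^ 2 = ∑ s ∈ Finset.range S, Q s := by
    rw [hsplit]
  rw [hsplit, hUQ]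
  calc _ ≤ ∑ s ∈ Finset.range S, ∑ t ∈ Finset.range A.T, ∑ k ∈ Finset.range A.K,
        3 * (2 * θ * (4 * L ^ 2 / A.b * (A.η ^ 2 * R (A.T * s + t)) + ρ) +
        ζ ^ 2 * (A.K * (A.η ^ 2 * R (A.T * s + t))) +
        2 * θ * (4 * L ^ 2 / (P * A.b) * (A.η ^ 2 * Q s) + ρ)) :=
        Finset.sum_le_sum fun s hs => Finset.sum_le_sum fun t ht => Finset.sum_le_sum fun k hk =>
          herr s (Finset.mem_range.1 hs) t (Finset.mem_range.1 ht) k (Finset.mem_range.1 hk)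
    _ = ∑ s ∈ Finset.range S, (3 * (8 * θ * L ^ 2 * A.η ^ 2 * A.K / A.b +
          (A.K * ζ) ^ 2 * A.η ^ 2 +
          8 * θ * L ^ 2 * A.η ^ 2 * (A.K * A.T / (P * A.b))) * Q s +
          12 * θ * ρ * (A.K * A.T)) := by
        -- Each R is counted K times and each Q is counted KT times, which produces the factors K/b,
        -- K² ζ² and KT/(Pb).
        refine Finset.sum_congr rfl fun s _ => ?_
        simp only [Finset.sum_const, Finset.card_range, nsmul_eq_mul]
        rw [← Finset.mul_sum, ← Finset.mul_sum, Finset.sum_add_distrib, Finset.sum_add_distrib,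
          ← Finset.mul_sum, Finset.sum_add_distrib, ← Finset.mul_sum, ← Finset.mul_sum,
          ← Finset.mul_sum, ← Finset.mul_sum, ← Finset.mul_sum, Finset.sum_const, Finset.sum_const,
          Finset.card_range, nsmul_eq_mul, nsmul_eq_mul]
        change _ * (3 * (2 * θ * (4 * L ^ 2 / A.b * (A.η ^ 2 * Q s) + _) +
          ζ ^ 2 * (A.K * (A.η ^ 2 * Q s)) + _)) = _
        field_simp
        ring
    _ = _ := by
        rw [Finset.sum_add_distrib, ← Finset.mul_sum, Finset.sum_const, Finset.card_range,
          nsmul_eq_mul]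
        ring

end Deterministic

/-! ### Descent with inexact gradients and perturbations -/

section Descent

variable {d : ℕ} {f : E d → ℝ} {L : ℝ}

/-- Polarisation of the inner product in the quadratic upper bound. The negative multiple of ‖v -
ξ‖² is retained because it has to absorb the accumulated error. -/
lemma descent_step (hf : Differentiable ℝ f)
    (hL : ∀ x y, ‖gradient f x - gradient f y‖ ≤ L * ‖x - y‖) {η r : ℝ} (hη : 0 ≤ η) (x v ξ : E d)
    (hξ : ‖ξ‖ ≤ r) :
    f (x - η • (v - ξ)) ≤ f x - η / 2 * ‖gradient f x‖ ^ 2 - η / 2 * (1 - L * η) * ‖v - ξ‖ ^ 2 +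
      η * (‖v - gradient f x‖ ^ 2 + r ^ 2) := by
  have h1 := le_quadratic_of_lipschitz_gradient hf hL x (-(η • (v - ξ)))
  rw [← sub_eq_add_neg, inner_neg_right, inner_smul_right, norm_neg, norm_smul,
    Real.norm_of_nonneg hη] at h1
  have h2 := norm_sub_sq_real (gradient f x) (v - ξ)
  have h3 : ‖gradient f x - (v - ξ)‖ ≤ ‖v - gradient f x‖ + r := by
    calc _ = ‖ξ - (v - gradient f x)‖ := by congr 1; abel
      _ ≤ ‖ξ‖ + ‖v - gradient f x‖ := norm_sub_le _ _
      _ ≤ _ := by linarith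
  have h4 : ‖gradient f x - (v - ξ)‖ ^ 2 ≤ 2 * (‖v - gradient f x‖ ^ 2 + r ^ 2) := by
    nlinarith [norm_nonneg (gradient f x - (v - ξ)), sq_nonneg (‖v - gradient f x‖ - r)]
  nlinarith

lemma sum_descent (hf : Differentiable ℝ f)
    (hL : ∀ x y, ‖gradient f x - gradient f y‖ ≤ L * ‖x - y‖) {η r : ℝ} (hη : 0 ≤ η)
    {x v ξ : ℕ → E d} (hξ : ∀ i, ‖ξ i‖ ≤ r) (hx : ∀ i, x (i + 1) = x i - η • (v i - ξ (i + 1)))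
    (n : ℕ) :
    f (x n) ≤ f (x 0) - η / 2 * ∑ i ∈ Finset.range n, ‖gradient f (x i)‖ ^ 2 -
      η / 2 * (1 - L * η) * ∑ i ∈ Finset.range n, ‖v i - ξ (i + 1)‖ ^ 2 +
      η * (∑ i ∈ Finset.range n, ‖v i - gradient f (x i)‖ ^ 2 + n * r ^ 2) := by
  induction n with
  | zero => simp
  | succ n ih =>
    have := descent_step hf hL hη (x n) (v n) (ξ (n + 1)) (hξ _)
    rw [← hx] at this
    simp only [Finset.sum_range_succ]
    push_cast
    linarith

lemma norm_gradient_perturbed_ge (hL : ∀ x y, ‖gradient f x - gradient f y‖ ≤ L * ‖x - y‖)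
    {η ε : ℝ} (hη : 0 ≤ η) (hLη : L * η ≤ 1 / 100) {x ξ : E d} (hξ : ‖ξ‖ ≤ ε / 10)
    (hx : ε ≤ ‖gradient f x‖) :
    99 / 100 * ‖gradient f x‖ ^ 2 ≤ ‖gradient f (x + η • ξ)‖ ^ 2 := by
  have h1 := hL x (x + η • ξ)
  rw [sub_add_cancel_left, norm_neg, norm_smul, Real.norm_of_nonneg hη, ← mul_assoc] at h1
  have h2 : L * η * ‖ξ‖ ≤ 1 / 100 * (ε / 10) :=
    mul_le_mul hLη hξ (norm_nonneg _) (by norm_num)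
  have h3 := norm_sub_norm_le (gradient f x) (gradient f (x + η • ξ))
  have h5 : 999 / 1000 * ‖gradient f x‖ ≤ ‖gradient f (x + η • ξ)‖ := by linarith
  have h6 := norm_nonneg (gradient f x)
  nlinarith

/-- The cost of the initial perturbation is measured by ‖∇f(x)‖² and not by ε², so that the descent
of the initial step pays for it. -/
lemma perturbed_le (hf : Differentiable ℝ f)
    (hL : ∀ x y, ‖gradient f x - gradient f y‖ ≤ L * ‖x - y‖)
    {η : ℝ} (hη : 0 ≤ η) (hLη : L * η ≤ 1 / 100) {x ξ : E d}
    (hξ : ‖ξ‖ ≤ ‖gradient f x‖ / 10) :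
    f (x + η • ξ) ≤ f x + η * (11 / 100 * ‖gradient f x‖ ^ 2) := by
  have h1 := le_quadratic_of_lipschitz_gradient hf hL x (η • ξ)
  rw [inner_smul_right, norm_smul, Real.norm_of_nonneg hη] at h1
  generalize hg : ‖gradient f x‖ = g at *
  have hg0 : 0 ≤ g := hg ▸ norm_nonneg _
  have h2 : inner ℝ (gradient f x) ξ ≤ g * (g / 10) :=
    (real_inner_le_norm _ _).trans (by rw [hg]; gcongr)
  have h3 : ‖ξ‖ ^ 2 ≤ g ^ 2 / 100 := by nlinarith [norm_nonneg ξ]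
  have h4 : L * η * ‖ξ‖ ^ 2 ≤ 1 / 100 * (g ^ 2 / 100) :=
    mul_le_mul hLη h3 (by positivity) (by norm_num)
  have h5 := mul_le_mul_of_nonneg_left h2 hη
  have h6 := mul_le_mul_of_nonneg_left h4 hη
  have h7 : 0 ≤ η * g ^ 2 := by positivity
  linarith

/-- If none of the first `N` iterates is `ε`-stationary, then the objective has decreased by at
least a multiple of `η N ε²`, whether measured from the initial point or from its perturbation. -/
lemma lower_bound_of_not_stationary (hf : Differentiable ℝ f)
    (hL : ∀ x y, ‖gradient f x - gradient f y‖ ≤ L * ‖x - y‖) {η r ε fmin : ℝ}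
    (hη : 0 ≤ η) (hLη : L * η ≤ 1 / 100) (hε : 0 < ε) (hr : r ≤ ε / 10) {x xt v ξ : ℕ → E d}
    (hξ : ∀ i, ‖ξ i‖ ≤ r) (hxt : ∀ i, x i = xt i + η • ξ i)
    (hx : ∀ i, x (i + 1) = x i - η • (v i - ξ (i + 1))) (hmin : ∀ y, fmin ≤ f y) {N : ℕ}
    (hN : 0 < N)
    (herr : ∑ i ∈ Finset.range N, ‖v i - gradient f (x i)‖ ^ 2 ≤
      1 / 10 * (∑ i ∈ Finset.range N, ‖v i - ξ (i + 1)‖ ^ 2) + ε ^ 2 / 100 * N)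
    (hall : ∀ i < N, ε < ‖gradient f (xt i)‖) :
    η * N * ε ^ 2 / 4 ≤ f (x 0) - fmin ∧ η * N * ε ^ 2 / 4 ≤ f (xt 0) - fmin := by
  have hr0 : 0 ≤ r := (norm_nonneg _).trans (hξ 0)
  have hr2 : r ^ 2 ≤ ε ^ 2 / 100 := by nlinarith
  have hgrad : ∀ i < N, 99 / 100 * ‖gradient f (xt i)‖ ^ 2 ≤ ‖gradient f (x i)‖ ^ 2 := by
    intro i hi
    rw [hxt i]
    exact norm_gradient_perturbed_ge hL hη hLη ((hξ i).trans hr) (hall i hi).le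
  -- The initial gradient is kept exactly, to be set against the cost 11/100 of passing from x̃_0 to
  -- x_0; the others are bounded below by ε.
  have hgsum : 99 / 100 * (‖gradient f (xt 0)‖ ^ 2 + (N - 1) * ε ^ 2) ≤
      ∑ i ∈ Finset.range N, ‖gradient f (x i)‖ ^ 2 := by
    obtain ⟨n, rfl⟩ : ∃ n, N = n + 1 := ⟨N - 1, by omega⟩
    rw [Finset.sum_range_succ']
    have h1 : ∑ i ∈ Finset.range n, 99 / 100 * ε ^ 2 ≤
        ∑ i ∈ Finset.range n, ‖gradient f (x (i + 1))‖ ^ 2 := by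
      refine Finset.sum_le_sum fun i hi => ?_
      have hi' : i + 1 < n + 1 := by simpa using hi
      refine le_trans ?_ (hgrad _ hi')
      have := (hall _ hi').le
      gcongr
    have h2 := hgrad 0 (by omega)
    rw [Finset.sum_const, Finset.card_range, nsmul_eq_mul] at h1
    push_cast
    linarith
  have hinit : f (x 0) ≤ f (xt 0) + η * (11 / 100 * ‖gradient f (xt 0)‖ ^ 2) := by
    rw [hxt 0]
    exact perturbed_le hf hL hη hLη (by linarith [hξ 0, hall 0 hN])
  have hdesc := (hmin _).trans (sum_descent hf hL hη hξ hx N)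
  have hU0 : 0 ≤ ∑ i ∈ Finset.range N, ‖v i - ξ (i + 1)‖ ^ 2 :=
    Finset.sum_nonneg fun _ _ => by positivity
  have hN1 : (1 : ℝ) ≤ N := by exact_mod_cast hN
  have hg2 : ε ^ 2 ≤ ‖gradient f (xt 0)‖ ^ 2 := by
    have := (hall 0 hN).le
    gcongr
  generalize ∑ i ∈ Finset.range N, ‖v i - ξ (i + 1)‖ ^ 2 = U at *
  generalize ∑ i ∈ Finset.range N, ‖v i - gradient f (x i)‖ ^ 2 = W at *
  generalize ∑ i ∈ Finset.range N, ‖gradient f (x i)‖ ^ 2 = Y at *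
  generalize ‖gradient f (xt 0)‖ ^ 2 = g at *
  generalize (N : ℝ) = n at *
  generalize ε ^ 2 = e at *
  generalize f (x 0) = fx at *
  generalize f (xt 0) = fxt at *
  clear hgrad hall hxt hx hξ hL hmin hf
  have h1 := mul_le_mul_of_nonneg_left hgsum hη
  have h2 : η * (99 / 100) * U ≤ η * (1 - L * η) * U := by
    gcongr; linarith
  have h3 : η * (W + n * r ^ 2) ≤ η * (1 / 10 * U + e / 100 * n + n * (e / 100)) := by gcongr
  have h4 : 0 ≤ η * U := mul_nonneg hη hU0
  have h5 := mul_le_mul_of_nonneg_left hg2 hη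
  have h6 : 0 ≤ η * ((n - 1) * e) := mul_nonneg hη (mul_nonneg (by linarith) (by nlinarith))
  have h7 : 0 ≤ η * e := mul_nonneg hη (by nlinarith)
  constructor <;> linarith

end Descent

/-! ### Moving the samples into the supports -/

section Clip

open Classical in
/-- Replaces points outside the support of a distribution by a point of the support. -/
def clip {Z : Type*} (D : PMF Z) (z : Z) : Z :=
  if z ∈ D.support then z else D.support_nonempty.some

lemma clip_mem {Z : Type*} (D : PMF Z) (z : Z) : clip D z ∈ D.support := by
  unfold clip
  split_ifs with h
  · exact h
  · exact D.support_nonempty.some_mem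

lemma clip_of_mem {Z : Type*} {D : PMF Z} {z : Z} (h : z ∈ D.support) : clip D z = z := if_pos h

/-- The tape in which every sample has been moved to the support of its distribution. -/
def clipTape {d P : ℕ} {Z : Type*} (pb : Problem d P Z) (τ : Tape d P Z) : Tape d P Z where
  ξ := τ.ξ
  worker := τ.worker
  z p i l := clip (pb.D p) (τ.z p i l)

variable {d P : ℕ} {Z Ω : Type*} [MeasurableSpace Z] [MeasurableSingletonClass Z]
  {pb : Problem d P Z} [NeZero P] [mΩ : MeasurableSpace Ω] {r : ℝ} {μ : Measure Ω}
  {τ : Ω → Tape d P Z}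

omit [NeZero P] in
lemma measurable_clip {D : PMF Z} (hD : D.support.Finite) : Measurable (clip D) := by
  classical
  exact Measurable.ite hD.measurableSet measurable_id measurable_const

lemma ae_mem_support {D : PMF Z} (hD : D.support.Finite) :
    ∀ᵐ z ∂D.toMeasure, z ∈ D.support := by
  change D.toMeasure D.supportᶜ = 0
  rw [PMF.toMeasure_apply_eq_zero_iff _ hD.measurableSet.compl]
  exact disjoint_compl_right

/-- Clipping alters the tape only on a null set, and afterwards the samples lie in the supports for
every outcome, as the pointwise and measurability arguments require. Independence survives because
the generated σ-algebras only shrink. -/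
lemma IsSampling.clipTape (hS : IsSampling pb r μ τ) (hD : ∀ p, (pb.D p).support.Finite) :
    IsSampling pb r μ fun ω => clipTape pb (τ ω) where
  measurable_ξ := hS.measurable_ξ
  measurable_worker := hS.measurable_worker
  measurable_z p i l := (measurable_clip (hD p)).comp (hS.measurable_z p i l)
  law_ξ := hS.law_ξ
  law_worker := hS.law_worker
  law_z p i l := by
    calc _ = (μ.map fun ω => (τ ω).z p i l).map (clip (pb.D p)) :=
          (Measure.map_map (measurable_clip (hD p)) (hS.measurable_z p i l)).symm
      _ = (pb.D p).toMeasure.map id := by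
          rw [hS.law_z]
          refine Measure.map_congr ?_
          filter_upwards [ae_mem_support (hD p)] with z hz using clip_of_mem hz
      _ = _ := Measure.map_id
  indep := by
    have hle : ∀ a, drawSigma (fun ω => BVRLPSGD.clipTape pb (τ ω)) a ≤ drawSigma τ a := by
      intro a
      cases a with
      | ξ i => exact le_rfl
      | worker j => exact le_rfl
      | z p i l =>
        exact ((measurable_clip (hD p)).comp (comap_measurable fun ω => (τ ω).z p i l)).comap_le
    rw [iIndep_iff]
    intro s f hf
    exact (iIndep_iff _ _).1 hS.indep s fun i hi => hle i _ (hf i hi)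

lemma IsSampling.ae_clipTape_eq (hS : IsSampling pb r μ τ) (hD : ∀ p, (pb.D p).support.Finite) :
    ∀ᵐ ω ∂μ, BVRLPSGD.clipTape pb (τ ω) = τ ω := by
  have h : ∀ᵐ ω ∂μ, ∀ p i l, (τ ω).z p i l ∈ (pb.D p).support := by
    simp only [ae_all_iff]
    intro p i l
    refine ae_of_ae_map (hS.measurable_z p i l).aemeasurable ?_
    rw [hS.law_z]
    exact ae_mem_support (hD p)
  filter_upwards [h] with ω hω
  cases hτ : τ ω with
  | mk ξ w z =>
    rw [hτ] at hω
    simp only [BVRLPSGD.clipTape, Tape.mk.injEq, true_and]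
    funext p i l
    exact clip_of_mem (hω p i l)

omit [MeasurableSingletonClass Z] in
lemma IsSampling.ae_norm_ξ_le (hS : IsSampling pb r μ τ) : ∀ᵐ ω ∂μ, ∀ i, ‖(τ ω).ξ i‖ ≤ r := by
  rw [ae_all_iff]
  intro i
  refine ae_of_ae_map (p := fun x : E d => ‖x‖ ≤ r) (hS.measurable_ξ i).aemeasurable ?_
  rw [hS.law_ξ]
  filter_upwards [ae_cond_mem (μ := (volume : Measure (E d)))
    (Metric.isClosed_closedBall (x := (0 : E d)) (ε := r)).measurableSet] with x hx
  simpa using hx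

end Clip

/-! ### The step size and the failure probability -/

section StepSize

variable {P b K T S : ℕ} {L G ζ ε q c : ℝ}

lemma exp_one_le_mul_logArg (hK : 0 < K) (hT : 0 < T) (hS : 0 < S) (hG : 0 ≤ G) (hε : 0 < ε)
    (hq : 0 < q) :
    Real.exp 1 ≤ q * (Real.exp 1 * (K * T * S) * (1 + G / ε) / q) ∧
    (K * T * S : ℝ) * (1 + G / ε) ≤ q * (Real.exp 1 * (K * T * S) * (1 + G / ε) / q) := by
  have h1 : (1 : ℝ) ≤ K * T * S := by exact_mod_cast Nat.mul_pos (Nat.mul_pos hK hT) hS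
  have h2 : (1 : ℝ) ≤ 1 + G / ε := by
    have := div_nonneg hG hε.le
    linarith
  have h3 : 1 ≤ (K * T * S : ℝ) * (1 + G / ε) := one_le_mul_of_one_le_of_one_le h1 h2
  have h4 : (2 : ℝ) ≤ Real.exp 1 := by linarith [Real.exp_one_gt_d9]
  rw [mul_div_cancel₀ _ hq.ne', mul_assoc]
  constructor <;> nlinarith

lemma one_le_logFactor (hK : 0 < K) (hT : 0 < T) (hS : 0 < S) (hG : 0 ≤ G) (hε : 0 < ε)
    (hq : 0 < q) (hq1 : q ≤ 1) : 1 ≤ logFactor K T S G ε q := by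
  have h := (exp_one_le_mul_logArg hK hT hS hG hε hq).1
  have h0 := Real.exp_pos 1
  have hpos : 0 < Real.exp 1 * (K * T * S) * (1 + G / ε) / q := by
    by_contra hneg
    nlinarith [mul_nonneg hq.le (neg_nonneg.2 (not_lt.1 hneg))]
  rw [logFactor, Real.le_log_iff_exp_le hpos]
  nlinarith

lemma invStep_pos (hL : 0 < L) : 0 < invStep P b K T L ζ :=
  lt_max_of_lt_left (lt_max_of_lt_left hL)

/-- What an admissible step size is small compared to. -/
lemma step_bounds (hL : 0 < L) {η : ℝ} (hη : 0 < η) (hζ : 0 ≤ ζ)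
    (hθ : 1 ≤ logFactor K T S G ε q)
    (h : η ≤ maxStep c P b K T S L G ζ ε q) :
    L * η ≤ c ∧ (K * ζ) ^ 2 * η ^ 2 ≤ c ^ 2 ∧
      logFactor K T S G ε q * L ^ 2 * η ^ 2 * K / b ≤ c ^ 2 ∧
      logFactor K T S G ε q * L ^ 2 * η ^ 2 * (K * T / (P * b)) ≤ c ^ 2 := by
  set θ := logFactor K T S G ε q with hθdef
  have hinv : 0 < invStep P b K T L ζ := invStep_pos hL
  have hsθ : 1 ≤ Real.sqrt θ := Real.one_le_sqrt.2 hθ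
  have h1 : η * (invStep P b K T L ζ * Real.sqrt θ) ≤ c := by
    rw [maxStep, ← hθdef, le_div_iff₀ (by positivity)] at h
    exact h
  have key : ∀ y, 0 ≤ y → y ≤ invStep P b K T L ζ → y * η ≤ c ∧ θ * y ^ 2 * η ^ 2 ≤ c ^ 2 := by
    intro y hy0 hy
    have e1 : η * (y * Real.sqrt θ) ≤ c := le_trans (by gcongr) h1
    constructor
    · refine le_trans ?_ e1
      have : y * 1 ≤ y * Real.sqrt θ := by gcongr
      nlinarith
    · calc θ * y ^ 2 * η ^ 2 = (η * (y * Real.sqrt θ)) ^ 2 := by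
            rw [mul_pow, mul_pow, Real.sq_sqrt (by linarith)]; ring
        _ ≤ c ^ 2 := by gcongr
  have k1 := key L hL.le ((le_max_left _ _).trans (le_max_left _ _))
  have k2 := key (K * ζ) (by positivity) ((le_max_right _ _).trans (le_max_left _ _))
  have k3 := (key (L * Real.sqrt (K / b)) (by positivity)
    ((le_max_left _ _).trans (le_max_right _ _))).2
  have k4 := (key (L * Real.sqrt (K * T / (P * b))) (by positivity)
    ((le_max_right _ _).trans (le_max_right _ _))).2
  rw [mul_pow, Real.sq_sqrt (by positivity)] at k3 k4
  refine ⟨k1.1, ?_, ?_, ?_⟩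
  · rw [← mul_pow]
    exact pow_le_pow_left₀ (by positivity) k2.1 2
  · refine le_trans (le_of_eq ?_) k3; ring
  · refine le_trans (le_of_eq ?_) k4; ring

/-- The union bound over all iterations and all levels of the variance proxies. -/
lemma failure_prob_le {N a q n : ℝ} (hq : 0 < q) (hq1 : q ≤ 1) (haq : Real.exp 1 ≤ q * a)
    (hN0 : 0 ≤ N) (hN : N ≤ 2 * a) (hn : n ≤ 384002 * a ^ 3) :
    N * (n * (2 * Real.exp (-(20 * Real.log a)))) ≤ q := by
  have he1 : (2.7 : ℝ) ≤ Real.exp 1 := by linarith [Real.exp_one_gt_d9]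
  have ha0 : 0 < a := by
    by_contra hneg
    nlinarith [mul_nonneg hq.le (neg_nonneg.2 (not_lt.1 hneg))]
  have ha : 2.7 ≤ a := by nlinarith
  have he : Real.exp (-(20 * Real.log a)) = (a ^ 20)⁻¹ := by
    rw [Real.exp_neg, show (20 : ℝ) * Real.log a = Real.log (a ^ 20) by simp,
      Real.exp_log (by positivity)]
  have h15 : (2.7 : ℝ) ^ 15 ≤ a ^ 15 := by gcongr
  have hqa : 1536008 ≤ q * a * a ^ 15 := by
    calc (1536008 : ℝ) ≤ 2.7 * 2.7 ^ 15 := by norm_num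
      _ ≤ q * a * a ^ 15 := by gcongr; linarith
  -- The union costs a constant times a⁴ against a⁻²⁰. The remaining 1536008 a⁻¹⁶ is at most q
  -- because q a ≥ e and a ≥ 2.7 give q a¹⁶ ≥ 2.7¹⁶.
  calc N * (n * (2 * Real.exp (-(20 * Real.log a))))
      ≤ N * (384002 * a ^ 3 * (2 * Real.exp (-(20 * Real.log a)))) := by gcongr
    _ ≤ 2 * a * (384002 * a ^ 3 * (2 * Real.exp (-(20 * Real.log a)))) := by gcongr
    _ = 1536008 * a ^ 4 / a ^ 20 := by rw [he]; ring
    _ ≤ q * a * a ^ 15 * a ^ 4 / a ^ 20 := by gcongr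
    _ = q := by field_simp

end StepSize

/-! ### Stationary points with high probability -/

section Stationary

variable {d P : ℕ} {Z Ω : Type*} [MeasurableSpace Z] [MeasurableSingletonClass Z]
  {pb : Problem d P Z} {L G ζ : ℝ} {xstar xt0 : E d} [NeZero P] {τ : Ω → Tape d P Z}
  {K T b S : ℕ} {η r q ε : ℝ}

lemma exists_stationary_of_noiseBounded {hA : pb.Assumptions L G ζ xstar} {ω : Ω} (hL : 0 < L)
    (hK : 0 < K) (hT : 0 < T) (hb : 0 < b) (hS : 0 < S) (hε : 0 < ε) (hη : 0 < η)
    (hr : r ≤ 1 / 10 * ε) (hθ : 1 ≤ logFactor K T S G ε q)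
    (hstep : η ≤ maxStep (1 / 100) P b K T S L G ζ ε q) (hξ : ∀ i, ‖(τ ω).ξ i‖ ≤ r)
    (h : NoiseBounded hA ⟨η, b, K, T⟩ xt0 τ S (20 * logFactor K T S G ε q)
      (ε ^ 2 / (1200 * (20 * logFactor K T S G ε q))) ω)
    (hlarge : (S : ℝ) ≥ 8 * ((pb.obj xt0 - pb.obj xstar) / (η * K * T * ε ^ 2)) ∨
      (S : ℝ) ≥ 8 * ((pb.obj (run pb ⟨η, b, K, T⟩ xt0 (τ ω) 0).x - pb.obj xstar) /
        (η * K * T * ε ^ 2))) :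
    ∃ i < K * T * S, ‖gradient pb.obj (run pb ⟨η, b, K, T⟩ xt0 (τ ω) i).xt‖ ≤ ε := by
  by_contra! hall
  obtain ⟨h1, h2, h3, h4⟩ := step_bounds hL hη hA.ζ_nonneg hθ hstep
  set θ := logFactor K T S G ε q with hθdef
  have hN : 0 < K * T * S := Nat.mul_pos (Nat.mul_pos hK hT) hS
  have hu : ∀ i, iterate pb ⟨η, b, K, T⟩ xt0 (τ ω) (i + 1) =
      iterate pb ⟨η, b, K, T⟩ xt0 (τ ω) i -
        η • (gradEst pb ⟨η, b, K, T⟩ xt0 (τ ω) i - (τ ω).ξ (i + 1)) := by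
    intro i
    rw [iterate_succ, smul_sub]
    abel
  have herr := h.sum_error_sq_le hL.le hK hb (by linarith) hu
  have hU0 : 0 ≤ ∑ i ∈ Finset.range (K * T * S),
      ‖gradEst pb ⟨η, b, K, T⟩ xt0 (τ ω) i - (τ ω).ξ (i + 1)‖ ^ 2 :=
    Finset.sum_nonneg fun _ _ => by positivity
  have herr' : ∑ i ∈ Finset.range (K * T * S), ‖gradEst pb ⟨η, b, K, T⟩ xt0 (τ ω) i -
      gradient pb.obj (iterate pb ⟨η, b, K, T⟩ xt0 (τ ω) i)‖ ^ 2 ≤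
      1 / 10 * (∑ i ∈ Finset.range (K * T * S),
        ‖gradEst pb ⟨η, b, K, T⟩ xt0 (τ ω) i - (τ ω).ξ (i + 1)‖ ^ 2) +
      ε ^ 2 / 100 * (K * T * S : ℕ) := by
    rw [mul_assoc K T S]
    refine herr.trans (add_le_add ?_ (le_of_eq ?_))
    · rw [mul_assoc K T S] at hU0
      refine mul_le_mul_of_nonneg_right ?_ hU0
      have e1 : 8 * (20 * θ) * L ^ 2 * η ^ 2 * K / b = 160 * (θ * L ^ 2 * η ^ 2 * K / b) := by ring
      have e2 : 8 * (20 * θ) * L ^ 2 * η ^ 2 * (K * T / (P * b)) =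
        160 * (θ * L ^ 2 * η ^ 2 * (K * T / (P * b))) := by ring
      simp only [e1, e2]
      -- With c = 1/100 the coefficient is at most 3(160 + 1 + 160)/100² = 0.0963 ≤ 1/10.
      norm_num at h2 h3 h4
      linarith
    -- The floor ρ is chosen so that 12 · 20 log(…) · ρ = ε²/100.
    · push_cast
      field_simp
      norm_num
  have hlow := lower_bound_of_not_stationary
    (fun x => (hA.hasGradientAt_obj x).differentiableAt) hA.norm_gradient_obj_sub_le
    hη.le h1 hε (by linarith) hξ iterate_eq_xt_add hu hA.minimizer hN herr' hall
  have hpos : 0 < η * K * T * ε ^ 2 := by positivity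
  have hNpos : 0 < η * (K * T * S : ℕ) * ε ^ 2 := by
    have : (0 : ℝ) < (K * T * S : ℕ) := by exact_mod_cast hN
    positivity
  push_cast at hlow hNpos
  -- The constant 8 is twice the 4 of the decrease, so the positive quantity η K T S ε² would be at
  -- most half of itself.
  rcases hlarge with hl | hl
  · rw [ge_iff_le, ← mul_div_assoc, div_le_iff₀ hpos] at hl
    have := hlow.2
    change _ ≤ pb.obj xt0 - pb.obj xstar at this
    linarith
  · rw [ge_iff_le, ← mul_div_assoc, div_le_iff₀ hpos] at hl
    have := hlow.1
    change _ ≤ pb.obj (run pb ⟨η, b, K, T⟩ xt0 (τ ω) 0).x - pb.obj xstar at this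
    linarith

variable [mΩ : MeasurableSpace Ω] {μ : Measure Ω} [IsProbabilityMeasure μ]

/-- The argument a of the logarithm dominates all counts: there are at most 2a events and at most
384002 a³ levels, where 384000 = 16 · 1200 · 20. -/
lemma IsSampling.measure_not_noiseBounded_le_ofReal (hS : IsSampling pb r μ τ)
    (hA : pb.Assumptions L G ζ xstar) (hL : 0 ≤ L)
    (hsupp : ∀ ω p i l, (τ ω).z p i l ∈ (pb.D p).support) (hK : 0 < K) (hT : 0 < T) (hb : 0 < b)
    (hS0 : 0 < S) (hε : 0 < ε) (hq : 0 < q) (hq1 : q ≤ 1) :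
    μ {ω | ¬ NoiseBounded hA ⟨η, b, K, T⟩ xt0 τ S (20 * logFactor K T S G ε q)
      (ε ^ 2 / (1200 * (20 * logFactor K T S G ε q))) ω} ≤ ENNReal.ofReal q := by
  have hG := hA.G_nonneg
  have hθ1 := one_le_logFactor hK hT hS0 hG hε hq hq1
  obtain ⟨ha1, ha2⟩ := exp_one_le_mul_logArg hK hT hS0 hG hε hq
  rw [logFactor] at hθ1 ⊢
  set a : ℝ := Real.exp 1 * (K * T * S) * (1 + G / ε) / q with hadef
  have hK1 : (1 : ℝ) ≤ K := by exact_mod_cast hK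
  have hT1 : (1 : ℝ) ≤ T := by exact_mod_cast hT
  have hS1 : (1 : ℝ) ≤ S := by exact_mod_cast hS0
  have hKT1 : (1 : ℝ) ≤ K * T := one_le_mul_of_one_le_of_one_le hK1 hT1
  have hN1 : (1 : ℝ) ≤ K * T * S := one_le_mul_of_one_le_of_one_le hKT1 hS1
  have hg0 : 0 ≤ G / ε := div_nonneg hG hε.le
  have ha0 : 0 < a := by rw [hadef]; positivity
  have hqa : q * a ≤ a := mul_le_of_le_one_left ha0.le hq1
  have ha : (1 : ℝ) ≤ a := by linarith [Real.exp_one_gt_d9]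
  have hNa : (K * T * S : ℝ) ≤ a := by nlinarith
  have hga : (K * T : ℝ) * (G / ε) ^ 2 ≤ a ^ 2 := by
    have e1 : (K * T : ℝ) * (G / ε) ≤ a := by
      calc (K * T : ℝ) * (G / ε) ≤ (K * T * S) * (1 + G / ε) := by
            refine mul_le_mul (le_mul_of_one_le_right (by positivity) hS1) (by linarith) hg0 ?_
            positivity
        _ ≤ a := ha2.trans hqa
    have e2 : G / ε ≤ a := by nlinarith
    nlinarith
  have hloga : Real.log a ≤ a := (Real.log_le_sub_one_of_pos ha0).trans (by linarith)
  set ρ : ℝ := ε ^ 2 / (1200 * (20 * Real.log a)) with hρ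
  have hθ0 : 0 < Real.log a := by linarith
  have hρ0 : 0 < ρ := by positivity
  set m : ℕ := ⌈16 * G ^ 2 * (K * T) / ρ⌉₊ with hm
  have hmρ : 16 * G ^ 2 * (K * T) ≤ m * ρ := by
    rw [← div_le_iff₀ hρ0]; exact Nat.le_ceil _
  have hmle : (m : ℝ) + 1 ≤ 384002 * a ^ 3 := by
    have e1 : 16 * G ^ 2 * (K * T) / ρ = 384000 * ((K * T * (G / ε) ^ 2) * Real.log a) := by
      rw [hρ]; field_simp; ring
    have e2 : (m : ℝ) ≤ 16 * G ^ 2 * (K * T) / ρ + 1 := (Nat.ceil_lt_add_one (by positivity)).le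
    have e3 : (K * T * (G / ε) ^ 2) * Real.log a ≤ a ^ 2 * a := by gcongr
    have e4 : 1 ≤ a ^ 3 := one_le_pow₀ ha
    rw [e1] at e2
    nlinarith
  refine (hS.measure_not_noiseBounded_le hA hL hsupp hK hb S (by positivity) hρ0 (m := m)
    (le_trans ?_ hmρ) (le_trans ?_ hmρ)).trans (ENNReal.ofReal_le_ofReal
      (failure_prob_le hq hq1 ha1 (by positivity) ?_ hmle))
  · gcongr
    exact le_mul_of_one_le_right (by positivity) hT1
  · gcongr
    exact le_mul_of_one_le_left (by positivity) hK1
  · change (T * S * K + S * T : ℝ) ≤ 2 * a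
    nlinarith [mul_pos (show (0 : ℝ) < S by linarith) (show (0 : ℝ) < T by linarith)]

-- Subadditivity of the outer measure suffices, so the success event need not be measurable.
omit [MeasurableSpace Z] [MeasurableSingletonClass Z] [NeZero P] in
lemma one_sub_le_measureReal {B A : Set Ω} {δ : ℝ} (hδ : 0 ≤ δ) (hB : μ B ≤ ENNReal.ofReal δ)
    (h : ∀ᵐ ω ∂μ, ω ∉ B → ω ∈ A) : 1 - δ ≤ μ.real A := by
  have h1 : μ Aᶜ ≤ μ B := measure_mono_ae (by
    filter_upwards [h] with ω hω hA
    by_contra hB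
    exact hA (hω hB))
  have h2 : (1 : ENNReal) ≤ μ A + ENNReal.ofReal δ := by
    calc (1 : ENNReal) = μ (A ∪ Aᶜ) := by rw [Set.union_compl_self, measure_univ]
      _ ≤ μ A + μ Aᶜ := measure_union_le _ _
      _ ≤ _ := by gcongr; exact h1.trans hB
  have h3 := ENNReal.toReal_mono (by finiteness) h2
  rw [ENNReal.toReal_add (by finiteness) (by finiteness), ENNReal.toReal_ofReal hδ] at h3
  rw [measureReal_def]
  simp only [ENNReal.toReal_one] at h3
  linarith

/-- The guarantee for the iterates. -/
theorem IsSampling.prob_exists_stationary (hS : IsSampling pb r μ τ)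
    (hA : pb.Assumptions L G ζ xstar) (hL : 0 < L) (hK : 0 < K) (hT : 0 < T) (hb : 0 < b)
    (hS0 : 0 < S) (hq : 0 < q) (hq1 : q ≤ 1) (hε : 0 < ε) (hη : 0 < η) (hr : r ≤ 1 / 10 * ε)
    (hstep : η ≤ maxStep (1 / 100) P b K T S L G ζ ε q) :
    1 - 3 * q ≤ μ.real {ω |
      ((S : ℝ) ≥ 8 * ((pb.obj xt0 - pb.obj xstar) / (η * K * T * ε ^ 2)) ∨
        (S : ℝ) ≥ 8 * ((pb.obj (run pb ⟨η, b, K, T⟩ xt0 (τ ω) 0).x - pb.obj xstar) /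
          (η * K * T * ε ^ 2))) →
      ∃ i < K * T * S, ‖gradient pb.obj (run pb ⟨η, b, K, T⟩ xt0 (τ ω) i).xt‖ ≤ ε} := by
  have hS' := hS.clipTape hA.finite_support
  have hbad := hS'.measure_not_noiseBounded_le_ofReal (η := η) (xt0 := xt0) hA hL.le
    (fun ω p i l => clip_mem _ _) hK hT hb hS0 hε hq hq1
  have hθ := one_le_logFactor hK hT hS0 hA.G_nonneg hε hq hq1
  -- The good event fails with probability at most q, which is within the allowed 3q.
  refine le_trans (by linarith) (one_sub_le_measureReal hq.le hbad ?_)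
  filter_upwards [hS.ae_clipTape_eq hA.finite_support, hS.ae_norm_ξ_le] with ω hω hξ hgood hlarge
  have := exists_stationary_of_noiseBounded (τ := fun ω => BVRLPSGD.clipTape pb (τ ω)) hL hK hT hb
    hS0 hε hη hr hθ hstep hξ (not_not.1 hgood)
  rw [hω] at this
  exact this hlarge

end Stationary

/-! ### The number of communications -/

section Communication

variable {P b K T : ℕ} {L G ζ ε q Δ : ℝ}

lemma invStep_mul_le (hP : 0 < P) (hb : 0 < b) (hK : 0 < K) (hL : 0 ≤ L) (hζ : 0 ≤ ζ)
    (hΔ : 0 ≤ Δ) :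
    invStep P b K T L ζ * Δ / ε ^ 2 ≤ K * mainTerm P b K T L ζ Δ ε := by
  have hP0 : (0 : ℝ) < P := by exact_mod_cast hP
  have hb0 : (0 : ℝ) < b := by exact_mod_cast hb
  have hK0 : (0 : ℝ) < K := by exact_mod_cast hK
  have e1 : Real.sqrt (K / b) = K / Real.sqrt (K * b) := by
    rw [show (K : ℝ) / b = K ^ 2 / (K * b) by field_simp, Real.sqrt_div (sq_nonneg _),
      Real.sqrt_sq hK0.le]
  have e2 : Real.sqrt (K * T / (P * b)) = K * Real.sqrt T / Real.sqrt (K * P * b) := by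
    rw [show (K : ℝ) * T / (P * b) = K ^ 2 * T / (K * P * b) by field_simp,
      Real.sqrt_div (by positivity), Real.sqrt_mul (sq_nonneg _), Real.sqrt_sq hK0.le]
  have hinv : invStep P b K T L ζ ≤ K * (L / K + ζ + L / Real.sqrt (K * b) +
      Real.sqrt T * L / Real.sqrt (K * P * b)) := by
    have h1 : K * (L / K + ζ + L / Real.sqrt (K * b) + Real.sqrt T * L / Real.sqrt (K * P * b)) =
        L + K * ζ + L * Real.sqrt (K / b) + L * Real.sqrt (K * T / (P * b)) := by
      rw [e1, e2]; field_simp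
    rw [h1, invStep]
    have a1 : 0 ≤ K * ζ := by positivity
    have a2 : 0 ≤ L * Real.sqrt (K / b) := by positivity
    have a3 : 0 ≤ L * Real.sqrt (K * T / (P * b)) := by positivity
    refine max_le (max_le ?_ ?_) (max_le ?_ ?_) <;> linarith
  calc invStep P b K T L ζ * Δ / ε ^ 2 ≤ K * (L / K + ζ + L / Real.sqrt (K * b) +
      Real.sqrt T * L / Real.sqrt (K * P * b)) * Δ / ε ^ 2 := by gcongr
    _ = _ := by rw [mainTerm]; ring

lemma mainTerm_nonneg (hL : 0 ≤ L) (hζ : 0 ≤ ζ) (hΔ : 0 ≤ Δ) :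
    0 ≤ mainTerm P b K T L ζ Δ ε := by
  unfold mainTerm; positivity

/-- A number of stages of the order of `M √(log (a (1 + M)))` exceeds `R M √(log (a S))`. -/
lemma exists_nat_ge_mul_sqrt_log {a M t R : ℝ} (ha : Real.exp 1 ≤ a) (hM : 0 ≤ M) (ht : 1 ≤ t)
    (hR : 1 ≤ R) :
    ∃ S : ℕ, 0 < S ∧ R * M * Real.sqrt (Real.log (a * S)) / t ≤ S ∧
      S * t ≤ t + 3 * R ^ 2 * M * Real.sqrt (Real.log (a * (1 + M))) := by
  set C := 3 * R ^ 2 with hC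
  set B := a * (1 + M) with hB
  have ha1 : 1 ≤ a := by linarith [Real.exp_one_gt_d9]
  have haB : a ≤ B := le_mul_of_one_le_right (by linarith) (by linarith)
  have hB0 : 0 < B := by linarith
  have hH1 : 1 ≤ Real.log B := by
    rw [Real.le_log_iff_exp_le hB0]; exact ha.trans haB
  set H := Real.log B with hH
  have hHB : H ≤ B := (Real.log_le_sub_one_of_pos hB0).trans (by linarith)
  have hsH : Real.sqrt H ≤ H := by
    rw [Real.sqrt_le_left (by linarith)]; nlinarith
  have hC0 : 3 ≤ C := by rw [hC]; nlinarith
  -- S = ⌊Y⌋ + 1 is polynomial in B, so log(a S) ≤ (C + 2) H. The value C = 3R² gives C + 2 ≤ (3R)²,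
  -- whose root times R is C again.
  set Y := C * M * Real.sqrt H / t with hY
  have hY0 : 0 ≤ Y := by positivity
  have hfl := Nat.floor_le hY0
  have hfl' := (Nat.lt_floor_add_one Y).le
  have hYle : Y ≤ C * M * B := by
    calc Y ≤ C * M * Real.sqrt H := div_le_self (by positivity) ht
      _ ≤ C * M * B := by gcongr; exact hsH.trans hHB
  refine ⟨⌊Y⌋₊ + 1, Nat.succ_pos _, ?_, ?_⟩
  · push_cast
    refine le_trans ?_ hfl'
    have hS : a * (⌊Y⌋₊ + 1 : ℝ) ≤ (1 + C) * B ^ 2 := by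
      have h1 : a * (⌊Y⌋₊ + 1 : ℝ) ≤ a * (C * M * B + 1) := by gcongr; linarith
      have h2 : a * M ≤ B := by rw [hB]; nlinarith
      have h3 : C * B * (a * M) ≤ C * B * B := by gcongr
      nlinarith
    have hlog : Real.log (a * (⌊Y⌋₊ + 1)) ≤ (C + 2) * H := by
      calc Real.log (a * (⌊Y⌋₊ + 1)) ≤ Real.log ((1 + C) * B ^ 2) :=
            Real.log_le_log (by positivity) hS
        _ = Real.log (1 + C) + 2 * H := by
            rw [Real.log_mul (by positivity) (by positivity), Real.log_pow]; norm_num [hH]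
        _ ≤ C + 2 * H := by
            have := Real.log_le_sub_one_of_pos (show 0 < 1 + C by linarith)
            linarith
        _ ≤ (C + 2) * H := by nlinarith
    have hsq : R * Real.sqrt (Real.log (a * (⌊Y⌋₊ + 1))) ≤ C * Real.sqrt H := by
      calc R * Real.sqrt (Real.log (a * (⌊Y⌋₊ + 1))) ≤ R * Real.sqrt ((3 * R) ^ 2 * H) := by
            gcongr
            refine hlog.trans ?_
            gcongr
            rw [hC]; nlinarith
        _ = C * Real.sqrt H := by
            rw [Real.sqrt_mul (sq_nonneg _), Real.sqrt_sq (by linarith), hC]; ring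
    rw [hY]
    gcongr ?_ / t
    nlinarith
  · push_cast
    have : Y * t = C * M * Real.sqrt H := by rw [hY]; field_simp
    nlinarith

lemma exists_commRounds_le (hP : 0 < P) (hb : 0 < b) (hK : 0 < K) (hT : 0 < T) (hL : 0 < L)
    (hζ : 0 ≤ ζ) (hG : 0 ≤ G) (hΔ : 0 ≤ Δ) (hε : 0 < ε) (hq : 0 < q) (hq1 : q ≤ 1) :
    ∃ (S : ℕ) (η : ℝ), 0 < S ∧ 0 < η ∧ η = maxStep (1 / 100) P b K T S L G ζ ε q ∧
      (S : ℝ) ≥ 8 * (Δ / (η * K * T * ε ^ 2)) ∧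
      (commRounds T S : ℝ) ≤ 5760000 * (T + mainTerm P b K T L ζ Δ ε *
        Real.sqrt (Real.log (Real.exp 1 * (K * T) * (1 + G / ε) *
          (1 + mainTerm P b K T L ζ Δ ε) / q))) := by
  have hK0 : (0 : ℝ) < K := by exact_mod_cast hK
  have hT1 : (1 : ℝ) ≤ T := by exact_mod_cast hT
  have hinv : 0 < invStep P b K T L ζ := invStep_pos hL
  have hM := mainTerm_nonneg (P := P) (b := b) (K := K) (T := T) (ε := ε) hL.le hζ hΔ
  have hX := invStep_mul_le (T := T) (ε := ε) hP hb hK hL.le hζ hΔ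
  set M := mainTerm P b K T L ζ Δ ε with hMdef
  set a : ℝ := Real.exp 1 * (K * T) * (1 + G / ε) / q with ha
  have hae : Real.exp 1 ≤ a := by
    have h1 := (exp_one_le_mul_logArg (S := 1) hK hT one_pos hG hε hq).1
    have h2 : (0 : ℝ) ≤ a := by rw [ha]; positivity
    have h3 : q * a ≤ a := mul_le_of_le_one_left h2 hq1
    rw [Nat.cast_one, mul_one, ← ha] at h1
    linarith
  -- 800 = 8/c with c = 1/100.
  obtain ⟨S, hS, h1, h2⟩ := exists_nat_ge_mul_sqrt_log hae hM hT1 (R := 800) (by norm_num)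
  have hlogS : logFactor K T S G ε q = Real.log (a * S) := by
    rw [logFactor, ha]; congr 1; ring
  have hθ := one_le_logFactor hK hT hS hG hε hq hq1
  have hsθ : 0 < Real.sqrt (logFactor K T S G ε q) := Real.sqrt_pos.2 (by linarith)
  have hη : 0 < maxStep (1 / 100) P b K T S L G ζ ε q := by unfold maxStep; positivity
  refine ⟨S, _, hS, hη, rfl, ?_, ?_⟩
  · rw [ge_iff_le]
    refine le_trans ?_ h1
    rw [← hlogS]
    have hT0 : (0 : ℝ) < T := by linarith
    calc 8 * (Δ / (maxStep (1 / 100) P b K T S L G ζ ε q * K * T * ε ^ 2))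
        = 800 * ((invStep P b K T L ζ * Δ / ε ^ 2) / K) *
            Real.sqrt (logFactor K T S G ε q) / T := by
          unfold maxStep
          field_simp
          ring
      _ ≤ 800 * M * Real.sqrt (logFactor K T S G ε q) / T := by
          gcongr
          rw [div_le_iff₀ hK0]; linarith
  · have harg : Real.exp 1 * (K * T) * (1 + G / ε) * (1 + M) / q = a * (1 + M) := by
      rw [ha]; ring
    rw [harg, commRounds]
    have hS0 : (0 : ℝ) ≤ S := by positivity
    -- Hence S(1 + 2T) ≤ 3ST, and 5760000 = 3 · 3 · 800².
    have h3 : (S : ℝ) * 1 ≤ S * T := by gcongr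
    have h4 : 0 ≤ M * Real.sqrt (Real.log (a * (1 + M))) := by positivity
    push_cast
    linarith

end Communication

end BVRLPSGD

end

theorem corollary1 :
    -- universal constants
    ∃ c cr C C' : ℝ, 0 < c ∧ 0 < cr ∧ 0 < C ∧ 0 < C' ∧
    ∀ (d P : ℕ) [NeZero P] (Z : Type*) [MeasurableSpace Z] [MeasurableSingletonClass Z]
      (pb : BVRLPSGD.Problem d P Z) (L G ζ : ℝ) (xstar xt0 : BVRLPSGD.E d)
      (K T b : ℕ) (q ε : ℝ),
      0 < L → pb.Assumptions L G ζ xstar → 0 < K → 0 < T → 0 < b →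
      0 < q → q < 1 → 0 < ε →
      -- the guarantee for the iterates
      (∀ (S : ℕ) (η r : ℝ) (Ω : Type*) [MeasurableSpace Ω] (μ : MeasureTheory.Measure Ω)
          [MeasureTheory.IsProbabilityMeasure μ] (τ : Ω → BVRLPSGD.Tape d P Z),
        0 < S → 0 < r → r ≤ cr * ε →
        0 < η → η ≤ BVRLPSGD.maxStep c P b K T S L G ζ ε q →
        BVRLPSGD.IsSampling pb r μ τ →
        -- `S` is large in terms of the value at the given initial point `x̃_0`
        ((S : ℝ) ≥ C * ((pb.obj xt0 - pb.obj xstar) / (η * K * T * ε ^ 2)) →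
          1 - 3 * q ≤ μ.real {ω | ∃ i < K * T * S,
            ‖gradient pb.obj (BVRLPSGD.run pb ⟨η, b, K, T⟩ xt0 (τ ω) i).xt‖ ≤ ε}) ∧
        -- `S` is large in terms of the value at the perturbed, random initial point `x_0`
        1 - 3 * q ≤ μ.real {ω |
          (S : ℝ) ≥ C * ((pb.obj (BVRLPSGD.run pb ⟨η, b, K, T⟩ xt0 (τ ω) 0).x - pb.obj xstar) /
            (η * K * T * ε ^ 2)) →
          ∃ i < K * T * S,
            ‖gradient pb.obj (BVRLPSGD.run pb ⟨η, b, K, T⟩ xt0 (τ ω) i).xt‖ ≤ ε}) ∧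
      -- the number of communication rounds for which this can be achieved
      (∃ (S : ℕ) (η : ℝ), 0 < S ∧ 0 < η ∧ η = BVRLPSGD.maxStep c P b K T S L G ζ ε q ∧
        (S : ℝ) ≥ C * ((pb.obj xt0 - pb.obj xstar) / (η * K * T * ε ^ 2)) ∧
        (BVRLPSGD.commRounds T S : ℝ) ≤ C' * (T +
          BVRLPSGD.mainTerm P b K T L ζ (pb.obj xt0 - pb.obj xstar) ε *
          Real.sqrt (Real.log (Real.exp 1 * (K * T) * (1 + G / ε) *
            (1 + BVRLPSGD.mainTerm P b K T L ζ (pb.obj xt0 - pb.obj xstar) ε) / q)))) := by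
  refine ⟨1 / 100, 1 / 10, 8, 5760000, by norm_num, by norm_num, by norm_num, by norm_num, ?_⟩
  intro d P _ Z _ _ pb L G ζ xstar xt0 K T b q ε hL hA hK hT hb hq hq1 hε
  refine ⟨?_, BVRLPSGD.exists_commRounds_le (Nat.pos_of_ne_zero (NeZero.ne P)) hb hK hT hL
    hA.ζ_nonneg hA.G_nonneg (sub_nonneg.2 (hA.minimizer _)) hε hq hq1.le⟩
  intro S η r Ω _ μ _ τ hS _ hr hη hstep hτ
  have h := hτ.prob_exists_stationary (xt0 := xt0) hA hL hK hT hb hS hq hq1.le hε hη hr hstep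
  refine ⟨fun hlarge => h.trans ?_, h.trans ?_⟩
  · exact measureReal_mono fun ω hω => hω (Or.inl hlarge)
  · exact measureReal_mono fun ω hω hlarge => hω (Or.inr hlarge)
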